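/- Let $G=(V,E)$ be a finite, simple, undirected, connected graph. Let $D$ be its degree matrix, $\mathcal A$ its adjacency matrix, and $W=D^{-1}\mathcal A$ the transition matrix of the random walk on $G$. Let $\omega^\star=\lambda_2(W)$ be the second largest eigenvalue of $W$, counted with multiplicity. Let $$\Phi=\min\Big\{\frac{C(S)}{\sum_{i\in S}d_i}\;:\;\emptyset\ne S\subset V,\ \sum_{i\in S}d_i\le\tfrac12\sum_{i\in V}d_i\Big\}$$ be the conductance of $G$, where $d_i$ is the degree of $i$ and $C(S)$ is the number of edges between $S$ and $V\setminus S$. Let $\bar E=\{(a,b): a\in E,\ b\in V,\ b \text{ is an endpoint of } a\}$ be the edge set of the factor graph. Let $S\in\mathbb R^{\bar E\times V}$ be given by $S_{(a,b),c}=1$ if $b=c$ and $0$ otherwise. Let $Q\in\mathbb R^{\bar E\times\bar E}$ be the block diagonal matrix with one block $\left(\begin{smallmatrix}1&-1\\-1&1\end{smallmatrix}\right)$ for every $a\in E$. For $\gamma\in(0,2)$ (over-relaxation) and $\rho>0$ (penalty) put $$A=(I+\rho^{-1}Q)^{-1},\qquad B=S(S^\top S)^{-1}S^\top,\qquad T_A=I-\gamma(A+B-2BA).$$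 $T_A$ is the matrix of the over-relaxed ADMM iteration for $\min_z \frac12\sum_{(i,j)\in E}(z_i-z_j)^2$. Let $|\lambda_2(T_A)|$ be the second largest absolute value of a complex eigenvalue of $T_A$, counted with algebraic multiplicity. **Theorem.** Suppose that $G$ has a cycle of even length and that $\Phi\le\frac12$. Then $0\le\omega^\star<1$. Moreover, with $$\rho^\star=2\sqrt{1-(\omega^\star)^2},\qquad \gamma^\star=\frac{4}{3-\sqrt{(2-\rho^\star)/(2+\rho^\star)}},$$ one has $\rho^\star>0$, $\gamma^\star\in(0,2)$, and $$\tau_A^\star=\min_{\gamma\in(0,2),\ \rho>0}|\lambda_2(T_A)|=\gamma^\star-1,$$ and the minimum is attained at $(\gamma,\rho)=(\gamma^\star,\rho^\star)$ and at no other point of $(0,2)\times(0,\infty)$. -/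

import Mathlib

namespace ConsensusADMM

noncomputable section

variable {V : Type*} [Fintype V] [DecidableEq V] (G : SimpleGraph V) [DecidableRel G.Adj]

/-! Random walk on the graph -/

/-- The transition matrix `D⁻¹ A` of the random walk on `G`. -/
def transitionMatrix : Matrix V V ℝ :=
  (G.degMatrix ℝ)⁻¹ * G.adjMatrix ℝ

/-- The second entry, counted with multiplicity, of a multiset of real numbers listed in
decreasing order (`0` when the multiset has fewer than two members). -/
def secondLargest (m : Multiset ℝ) : ℝ :=
  (m.sort (· ≥ ·)).getD 1 0

/-- `ω* = λ₂(W)`: the second largest eigenvalue of the transition matrix, the eigenvalues being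
the roots of the characteristic polynomial with multiplicity (for this matrix all are real). -/
def omegaStar : ℝ :=
  secondLargest (transitionMatrix G).charpoly.roots

/-- The volume of a set of vertices: the sum of their degrees. -/
def vol (S : Finset V) : ℕ := ∑ i ∈ S, G.degree i

/-- The cut value of `S`: the number of edges between `S` and its complement. -/
def cut (S : Finset V) : ℕ := (G.interedges S Sᶜ).card

/-- The conductance of `G`: the minimum of `cut S / vol S` over the nonempty sets `S` of vertices
whose volume is at most half of the total volume. -/
def conductance : ℝ :=
  sInf {r : ℝ | ∃ S : Finset V, S.Nonempty ∧ 2 * vol G S ≤ vol G Finset.univ ∧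
    r = (cut G S : ℝ) / (vol G S : ℝ)}

/-! The linear iteration of over-relaxed ADMM -/

/-- The edges `(a, b)` of the factor graph: `a` is an edge of `G` (a function node, the term
`(z_i - z_j)² / 2` of the objective) and `b` is an endpoint of `a` (a variable node). -/
abbrev FactorEdge : Type _ := {e : G.edgeSet × V // e.2 ∈ (e.1 : Sym2 V)}

/-- The incidence matrix `S` of factor edges and variable nodes. -/
def incidence : Matrix (FactorEdge G) V ℝ :=
  Matrix.of fun e b => if e.1.2 = b then 1 else 0

/-- The block diagonal matrix `Q` with one block `!![1, -1; -1, 1]` for each function node. -/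
def Qmat : Matrix (FactorEdge G) (FactorEdge G) ℝ :=
  Matrix.of fun e e' => if e.1.1 = e'.1.1 then (if e.1.2 = e'.1.2 then 1 else -1) else 0

/-- `A = (I + ρ⁻¹ Q)⁻¹`, the proximal operator of the decoupled objective. -/
def Amat (ρ : ℝ) : Matrix (FactorEdge G) (FactorEdge G) ℝ :=
  (1 + ρ⁻¹ • Qmat G)⁻¹

/-- `B = S (Sᵀ S)⁻¹ Sᵀ`, the orthogonal projection onto the range of `S`. -/
def Bmat : Matrix (FactorEdge G) (FactorEdge G) ℝ :=
  incidence G * ((incidence G).transpose * incidence G)⁻¹ * (incidence G).transpose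

/-- `T_A = I - γ (A + B - 2 B A)`. -/
def TA (γ ρ : ℝ) : Matrix (FactorEdge G) (FactorEdge G) ℝ :=
  1 - γ • (Amat G ρ + Bmat G - (2 : ℝ) • (Bmat G * Amat G ρ))

/-- `|λ₂(T_A)|`: the second largest modulus of the complex eigenvalues of `T_A`, counted with
algebraic multiplicity. -/
def rate (γ ρ : ℝ) : ℝ :=
  secondLargest ((((TA G γ ρ).map Complex.ofReal).charpoly.roots).map fun z : ℂ => ‖z‖)

/-! The optimal parameters -/

/-- `ρ* = 2 √(1 - ω*²)`. -/
def rhoStar : ℝ := 2 * √(1 - omegaStar G ^ 2)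

/-- `γ* = 4 / (3 - √((2 - ρ*) / (2 + ρ*)))`. -/
def gammaStar : ℝ := 4 / (3 - √((2 - rhoStar G) / (2 + rhoStar G)))

end

end ConsensusADMM

namespace ConsensusADMM

/-! ### The second largest element of a multiset -/

/-! Write `c = ρ / 2`, let `F` be the permutation exchanging the two factor edges of each function
node, and let `P = D⁻¹Sᵀ`. Since `Q = 1 - F` and `F² = 1`, the matrix `A` is an affine function of
`F`, and `T_A = (1 - γ/2) + γ/(2(1+c)) U` with `U = (2SP - 1)(F + c)` (`TA_eq`). Here `2SP - 1` and
`F` are involutions and `PFS = W`, so an eigenvalue `u` of `U` either is `±1 - c` or satisfies `u² -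
2wu + 1 - c² = 0` for an eigenvalue `w` of `W` (`eigenvector_project`, `eigenvalue_cases`). The root
`u = 1 + c` at `w = 1` is the simple eigenvalue `1` of `T_A`.

Upper bound: choose `c² = 1 - ω²`, so that `w = ω` gives a double root. The roots for `|w| ≤ ω` then
lie on the circle `|u| = ω`, and all the others, except `1 + c`, are real in `[-(1+c), ω]`. Hence
every other eigenvalue of `T_A` has modulus at most the larger of `1 - γ/2 + (γ/2) ω/(1+c)` and `γ -
1` (`norm_le_of_quadratic`, `rate_le_of_double_root`); `γ*` equates the two.

Lower bound: signs alternating along an even cycle give the eigenvalue `1 - γ`, which excludes `γ >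
γ*` (`sub_one_le_rate`). For `γ ≤ γ*`, one of the two roots belonging to `w = ω` is already too
large unless both parameters are optimal (`exists_root_norm_gt`).

The conductance bound enters only through the easy half of Cheeger's inequality, which gives `ω ≥ 0`
(`omegaStar_spec`). -/

lemma secondLargest_mem {m : Multiset ℝ} (hm : 2 ≤ Multiset.card m) : secondLargest m ∈ m := by
  have hlen : 1 < (m.sort (· ≥ ·)).length := by rw [Multiset.length_sort]; omega
  unfold secondLargest
  rw [List.getD_eq_getElem _ _ hlen]
  exact (Multiset.mem_sort (· ≥ ·)).1 (List.getElem_mem hlen)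

lemma le_secondLargest {m : Multiset ℝ} {t : ℝ} (h : 2 ≤ m.countP (t ≤ ·)) :
    t ≤ secondLargest m := by
  unfold secondLargest
  have hs := Multiset.pairwise_sort m (· ≥ ·)
  rw [← Multiset.sort_eq m (· ≥ ·), Multiset.coe_countP] at h
  generalize m.sort (· ≥ ·) = l at hs h
  match l, hs, h with
  | [], _, h => simp at h
  | [x], _, h =>
    have := List.countP_le_length (p := fun y => decide (t ≤ y)) (l := [x])
    simp only [List.length_singleton] at this
    omega
  | x :: y :: l, hs, h =>
    show t ≤ y
    by_contra hy
    have h0 : (y :: l).countP (fun z => decide (t ≤ z)) = 0 := by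
      rw [List.countP_eq_zero]
      intro z hz
      have : z ≤ y := by
        rcases List.mem_cons.1 hz with rfl | hz
        · exact le_rfl
        · exact (List.pairwise_cons.1 (List.pairwise_cons.1 hs).2).1 z hz
      simp only [decide_eq_true_eq]
      intro h'
      exact hy (h'.trans this)
    rw [List.countP_cons, h0] at h
    split_ifs at h <;> omega

/-- The alternative in `hm` excludes the case where `secondLargest` is only the default value `0`.
-/
lemma two_le_countP_of_secondLargest {m : Multiset ℝ} {p : ℝ → Prop} [DecidablePred p]
    (hp : ∀ x y, x ≤ y → p x → p y) (hm : 2 ≤ Multiset.card m ∨ ¬ p 0)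
    (h : p (secondLargest m)) : 2 ≤ m.countP p := by
  unfold secondLargest at h
  have hs := Multiset.pairwise_sort m (· ≥ ·)
  rw [← Multiset.sort_eq m (· ≥ ·), Multiset.coe_card] at hm
  rw [← Multiset.sort_eq m (· ≥ ·), Multiset.coe_countP]
  generalize m.sort (· ≥ ·) = l at hs h hm
  match l, hs, h, hm with
  | [], _, h, hm => simp at hm; exact absurd h hm
  | [x], _, h, hm => simp at hm; exact absurd h hm
  | x :: y :: l, hs, h, _ =>
    have hy : p y := h
    have hx : p x := hp _ _ ((List.pairwise_cons.1 hs).1 y (by simp)) hy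
    rw [List.countP_cons, List.countP_cons]
    simp only [hx, hy, decide_true, if_true]
    omega

lemma le_secondLargest_map {α : Type*} {m : Multiset α} {f : α → ℝ} {x y : α} {t : ℝ}
    (hx : x ∈ m) (hy : y ∈ m) (hxy : x ≠ y) (htx : t ≤ f x) (hty : t ≤ f y) :
    t ≤ secondLargest (m.map f) := by
  obtain ⟨m, rfl⟩ := Multiset.exists_cons_of_mem hx
  obtain ⟨m, rfl⟩ := Multiset.exists_cons_of_mem
    ((Multiset.mem_cons.1 hy).resolve_left (Ne.symm hxy))
  apply le_secondLargest
  simp [htx, hty]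

/-! ### Simple eigenvalues -/

open Matrix Polynomial in
lemma mem_roots_charpoly_iff {K n : Type*} [Field K] [Fintype n] [DecidableEq n]
    {M : Matrix n n K} {μ : K} :
    μ ∈ M.charpoly.roots ↔ ∃ v : n → K, v ≠ 0 ∧ M *ᵥ v = μ • v := by
  rw [mem_roots (charpoly_monic M).ne_zero, IsRoot, eval_charpoly, ← exists_mulVec_eq_zero_iff]
  refine exists_congr fun v => and_congr_right fun _ => ?_
  rw [sub_mulVec, sub_eq_zero, scalar_apply, ← smul_one_eq_diagonal, smul_mulVec, one_mulVec,
    eq_comm]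

-- A left eigenvector `y` not orthogonal to `x` rules out Jordan blocks: if `(M - μ)v = αx`, pairing
-- with `y` gives `α = 0`. The generalized eigenspace therefore stays inside the line through `x`,
-- which bounds the algebraic multiplicity.
open Matrix Polynomial in
lemma count_roots_charpoly_le_one {K n : Type*} [Field K] [DecidableEq K] [Fintype n]
    [DecidableEq n] {M : Matrix n n K} {μ : K} {x y : n → K} (hy : y ᵥ* M = μ • y)
    (hyx : y ⬝ᵥ x ≠ 0) (hker : ∀ v, M *ᵥ v = μ • v → ∃ α : K, v = α • x) :
    M.charpoly.roots.count μ ≤ 1 := by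
  rw [count_roots, ← Matrix.charpoly_toLin', ← LinearMap.finrank_maxGenEigenspace_eq]
  have key : ∀ (k : ℕ) (v : n → K), ((toLin' M - μ • 1) ^ k) v = 0 → ∃ α : K, v = α • x := by
    intro k
    induction k with
    | zero => intro v hv; exact ⟨0, by simpa using hv⟩
    | succ k ih =>
      intro v hv
      rw [pow_succ, Module.End.mul_apply] at hv
      obtain ⟨α, hα⟩ := ih _ hv
      have hα' : M *ᵥ v - μ • v = α • x := by simpa using hα
      have h0 : y ⬝ᵥ (M *ᵥ v - μ • v) = 0 := by
        rw [dotProduct_sub, dotProduct_mulVec, hy, smul_dotProduct, dotProduct_smul, sub_self]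
      rw [hα', dotProduct_smul, smul_eq_mul, mul_eq_zero, or_iff_left hyx] at h0
      rw [h0, zero_smul, sub_eq_zero] at hα'
      exact hker v hα'
  have hle : Module.End.maxGenEigenspace (toLin' M) μ ≤ Submodule.span K {x} := by
    intro v hv
    rw [Module.End.mem_maxGenEigenspace] at hv
    obtain ⟨k, hk⟩ := hv
    obtain ⟨α, rfl⟩ := key k v hk
    exact Submodule.smul_mem _ _ (Submodule.mem_span_singleton_self x)
  exact (Submodule.finrank_mono hle).trans (by simpa using finrank_span_le_card (R := K) {x})

/-! ### Scalar estimates -/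

/-- A non-real root has real part `w` and modulus `ω`, so the bound follows by expanding the square.
A real root lies in `[-(1+c), ω]`, and the affine map is controlled at the two ends by `h2` and
`h1`. -/
lemma norm_le_of_quadratic {a b c ω w t : ℝ} {u : ℂ} (ha : 0 ≤ a) (hb : 0 ≤ b) (hc : 0 ≤ c)
    (hω : 0 ≤ ω) (hcω : c ^ 2 + ω ^ 2 = 1) (hw : -1 ≤ w) (hwω : w ≤ ω)
    (hu : 2 * u * w = 1 - (c : ℂ) ^ 2 + u ^ 2) (h1 : a + b * ω ≤ t) (h2 : -t ≤ a - b * (1 + c)) :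
    ‖(a : ℂ) + b * u‖ ≤ t := by
  have ht : 0 ≤ t := by nlinarith
  have hre := congrArg Complex.re hu
  have him := congrArg Complex.im hu
  simp [pow_two] at hre him
  have hn : ‖(a : ℂ) + b * u‖ ^ 2 = (a + b * u.re) ^ 2 + (b * u.im) ^ 2 := by
    rw [Complex.sq_norm, Complex.normSq_apply]; simp; ring
  apply le_of_sq_le_sq _ ht
  rw [hn]
  have hsq : (a + b * ω) ^ 2 ≤ t ^ 2 := by
    apply pow_le_pow_left₀ (by positivity) h1
  by_cases hy : u.im = 0
  · have h3 : 2 * u.re * w = ω ^ 2 + u.re ^ 2 := by rw [hy] at hre; nlinarith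
    have hub : u.re ≤ ω := by
      by_contra! h
      nlinarith [mul_pos (sub_pos.2 h) (sub_pos.2 h), mul_nonneg (hω.trans h.le) (sub_nonneg.2 hwω)]
    have hlb : -(1 + c) ≤ u.re := by
      by_contra! h
      -- By the quadratic, `(u+1)² = 2u(w+1) + c²`, where `u < 0 ≤ w + 1`.
      have : (u.re + 1) ^ 2 ≤ c ^ 2 := by nlinarith
      nlinarith
    rw [hy, mul_zero]
    have hl : -t ≤ a + b * u.re := by nlinarith
    have hr : a + b * u.re ≤ t := by nlinarith
    nlinarith
  · have hx : u.re = w := by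
      have : u.im * (u.re - w) = 0 := by linarith
      rcases mul_eq_zero.1 this with h | h
      · exact absurd h hy
      · linarith
    rw [hx] at hre ⊢
    have : u.im ^ 2 = ω ^ 2 - w ^ 2 := by nlinarith
    have h4 : (b * u.im) ^ 2 = b ^ 2 * (ω ^ 2 - w ^ 2) := by rw [mul_pow, this]
    rw [h4]
    nlinarith [mul_nonneg (mul_nonneg ha hb) (sub_nonneg.2 hwω)]

/-- At the critical value `c = k` the quadratic has the double root `ω`. Moving `c` either way
strictly enlarges the modulus: above `k` the larger real root has larger `u/(1+c)`; below `k` the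
roots are non-real, with `|u|²/(1+c)² = (1-c)/(1+c)` decreasing in `c`. Decreasing `γ` moves the
bound towards `1`. -/
lemma exists_root_norm_gt {c ω k γ γ' : ℝ} (hc : 0 < c) (hω : 0 ≤ ω) (hk : 0 < k)
    (hkω : k ^ 2 + ω ^ 2 = 1) (hγ : 0 < γ) (hγ2 : γ < 2) (hle : γ ≤ γ') (hne : γ = γ' → c ≠ k) :
    ∃ u : ℂ, 2 * u * ω = 1 - (c : ℂ) ^ 2 + u ^ 2 ∧
      1 - γ' / 2 * (1 - ω / (1 + k)) <
        ‖((1 - γ / 2 : ℝ) : ℂ) + ((γ / (2 * (1 + c)) : ℝ) : ℂ) * u‖ := by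
  have hω1 : ω < 1 := by nlinarith
  have hg : ω / (1 + k) < 1 := by rw [div_lt_one (by linarith)]; linarith
  have hγγ : 1 - γ' / 2 * (1 - ω / (1 + k)) ≤ 1 - γ / 2 + γ / 2 * (ω / (1 + k)) := by nlinarith
  rcases le_or_gt k c with hkc | hkc
  · set s := √(c ^ 2 - k ^ 2) with hs
    have hs2 : s ^ 2 = c ^ 2 - k ^ 2 := Real.sq_sqrt (by nlinarith)
    have hs0 : 0 ≤ s := Real.sqrt_nonneg _
    refine ⟨((ω + s : ℝ) : ℂ), ?_, ?_⟩
    · norm_cast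
      nlinarith
    · rw [← Complex.ofReal_mul, ← Complex.ofReal_add, Complex.norm_real, Real.norm_eq_abs]
      refine lt_of_lt_of_le ?_ (le_abs_self _)
      have hrw : γ / (2 * (1 + c)) * (ω + s) = γ / 2 * ((ω + s) / (1 + c)) := by field_simp
      rw [hrw]
      have hgle : ω / (1 + k) ≤ (ω + s) / (1 + c) ∧ (k < c → ω / (1 + k) < (ω + s) / (1 + c)) := by
        rcases hkc.eq_or_lt with rfl | hlt
        · refine ⟨?_, fun h => absurd h (lt_irrefl _)⟩
          gcongr; linarith
        · have : ω / (1 + k) < (ω + s) / (1 + c) := by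
            rw [div_lt_div_iff₀ (by linarith) (by linarith)]
            -- The cross-multiplied inequality with the common term `ω(1+k)` removed; both sides are
            -- squared and the factor `c - k` is split off.
            have : ω * (c - k) < s * (1 + k) := by
              apply lt_of_pow_lt_pow_left₀ 2 (by positivity)
              rw [mul_pow, mul_pow, hs2]
              have h1 : c ^ 2 - k ^ 2 = (c - k) * (c + k) := by ring
              have h2 : ω ^ 2 * (c - k) < (c + k) * (1 + k) ^ 2 := by nlinarith [mul_pos hc hk]
              rw [h1]
              nlinarith [mul_lt_mul_of_pos_left h2 (sub_pos.2 hlt)]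
            nlinarith
          exact ⟨this.le, fun _ => this⟩
      rcases hle.eq_or_lt with h | h
      · have := hgle.2 (lt_of_le_of_ne hkc (Ne.symm (hne h)))
        nlinarith
      · have := hgle.1
        nlinarith
  · set s := √(k ^ 2 - c ^ 2) with hs
    have hs2 : s ^ 2 = k ^ 2 - c ^ 2 := Real.sq_sqrt (by nlinarith)
    refine ⟨⟨ω, s⟩, ?_, ?_⟩
    · apply Complex.ext <;> simp [pow_two] <;> nlinarith
    · refine lt_of_le_of_lt hγγ ?_
      apply lt_of_pow_lt_pow_left₀ 2 (norm_nonneg _)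
      rw [Complex.sq_norm, Complex.normSq_apply]
      simp only [Complex.add_re, Complex.ofReal_re, Complex.re_ofReal_mul, Complex.add_im,
        Complex.ofReal_im, Complex.im_ofReal_mul, zero_add]
      have e1 : γ / (2 * (1 + c)) * ω = γ / 2 * (ω / (1 + c)) := by field_simp
      have e2 : γ / (2 * (1 + c)) * s = γ / 2 * (s / (1 + c)) := by field_simp
      rw [e1, e2]
      have h1 : ω / (1 + k) ≤ ω / (1 + c) := by gcongr
      have h2 : (ω / (1 + c)) ^ 2 + (s / (1 + c)) ^ 2 = (1 - c) / (1 + c) := by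
        rw [div_pow, div_pow, ← add_div, hs2, div_eq_div_iff (by positivity) (by positivity)]
        linear_combination (1 + c) * hkω
      have h3 : (ω / (1 + k)) ^ 2 = (1 - k) / (1 + k) := by
        rw [div_pow, div_eq_div_iff (by positivity) (by positivity)]
        linear_combination (1 + k) * hkω
      have h4 : (1 - k) / (1 + k) < (1 - c) / (1 + c) := by
        rw [div_lt_div_iff₀ (by linarith) (by linarith)]; linarith
      have h5 : 0 < (γ / 2) ^ 2 := by positivity
      have h6 : 0 ≤ (1 - γ / 2) * (γ / 2) := mul_nonneg (by linarith) (by linarith)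
      nlinarith [mul_lt_mul_of_pos_left h4 h5, mul_le_mul_of_nonneg_left h1 h6]


/-! ### Spectrum of a product of two reflections -/

open Matrix in
/-- Eigenvectors of `(2 S P - 1) (F + c)`, where `F` is an involution and `P` a left inverse
of `S`, project to eigenvectors of `P F S`. -/
lemma eigenvector_project {E V : Type*} [Fintype E] [DecidableEq E] [Fintype V] [DecidableEq V]
    {S : Matrix E V ℂ} {P : Matrix V E ℂ} {F : Matrix E E ℂ} (hPS : P * S = 1) (hF : F * F = 1)
    {c u : ℂ} {f : E → ℂ} (hu : ((2 : ℂ) • (S * P) - 1) *ᵥ (F *ᵥ f + c • f) = u • f) :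
    (1 - (c + u) ^ 2) • f = (2 * u) • (F *ᵥ (S *ᵥ (P *ᵥ f)) - (c + u) • (S *ᵥ (P *ᵥ f))) ∧
    (1 - (c + u) ^ 2) • (P *ᵥ f) =
      (2 * u) • ((P * F * S) *ᵥ (P *ᵥ f) - (c + u) • (P *ᵥ f)) := by
  have hFF : ∀ g : E → ℂ, F *ᵥ (F *ᵥ g) = g := fun g => by rw [mulVec_mulVec, hF, one_mulVec]
  have hPP : ∀ g : V → ℂ, P *ᵥ (S *ᵥ g) = g := fun g => by rw [mulVec_mulVec, hPS, one_mulVec]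
  have hR : ∀ g : E → ℂ, ((2 : ℂ) • (S * P) - 1) *ᵥ g = (2 : ℂ) • (S *ᵥ (P *ᵥ g)) - g := by
    intro g; rw [sub_mulVec, smul_mulVec, one_mulVec, mulVec_mulVec]
  have h1 : F *ᵥ f + c • f = u • ((2 : ℂ) • (S *ᵥ (P *ᵥ f)) - f) := by
    have := congrArg (((2 : ℂ) • (S * P) - 1) *ᵥ ·) hu
    simp only [mulVec_smul] at this
    rw [← hR f, ← this, hR, hR]
    simp only [mulVec_sub, mulVec_smul, hPP]
    module
  have h2 : f + c • (F *ᵥ f) = u • ((2 : ℂ) • (F *ᵥ (S *ᵥ (P *ᵥ f))) - F *ᵥ f) := by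
    have := congrArg (F *ᵥ ·) h1
    simpa only [mulVec_add, mulVec_sub, mulVec_smul, hFF] using this
  have h3 : (1 - (c + u) ^ 2) • f =
      (2 * u) • (F *ᵥ (S *ᵥ (P *ᵥ f)) - (c + u) • (S *ᵥ (P *ᵥ f))) := by
    linear_combination (norm := module) h2 - (c + u) • h1
  refine ⟨h3, ?_⟩
  have := congrArg (P *ᵥ ·) h3
  simp only [mulVec_sub, mulVec_smul, hPP] at this
  rw [this, ← mulVec_mulVec, ← mulVec_mulVec]

-- The witness is the right-hand side of the projection formula, `F S v - (c + u) S v`. If it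
-- vanished, applying `P` and `P F` would give `w = c + u` and `1 = (c + u) w`, hence `w² = 1`.
open Matrix in
lemma eigenvector_lift {E V : Type*} [Fintype E] [DecidableEq E] [Fintype V] [DecidableEq V]
    {S : Matrix E V ℂ} {P : Matrix V E ℂ} {F : Matrix E E ℂ} (hPS : P * S = 1) (hF : F * F = 1)
    {c u w : ℂ} {v : V → ℂ} (hv : v ≠ 0) (hw : w ^ 2 ≠ 1) (hW : (P * F * S) *ᵥ v = w • v)
    (hu : 2 * u * w = 1 - c ^ 2 + u ^ 2) :
    ∃ f : E → ℂ, f ≠ 0 ∧ ((2 : ℂ) • (S * P) - 1) *ᵥ (F *ᵥ f + c • f) = u • f := by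
  have hFF : ∀ g : E → ℂ, F *ᵥ (F *ᵥ g) = g := fun g => by rw [mulVec_mulVec, hF, one_mulVec]
  have hPP : ∀ g : V → ℂ, P *ᵥ (S *ᵥ g) = g := fun g => by rw [mulVec_mulVec, hPS, one_mulVec]
  have hPFS : P *ᵥ (F *ᵥ (S *ᵥ v)) = w • v := by rw [mulVec_mulVec, mulVec_mulVec, ← hW]
  refine ⟨F *ᵥ (S *ᵥ v) - (c + u) • (S *ᵥ v), fun h => ?_, ?_⟩
  · rw [sub_eq_zero] at h
    have h1 := congrArg (P *ᵥ ·) h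
    have h2 := congrArg (F *ᵥ ·) h
    simp only [mulVec_smul, hPP, hPFS, hFF] at h1 h2
    have h3 := congrArg (P *ᵥ ·) h2
    simp only [mulVec_smul, hPP, hPFS, smul_smul] at h3
    have e1 : w = c + u := smul_left_injective ℂ hv h1
    have e2 : (1 : ℂ) = (c + u) * w := smul_left_injective ℂ hv (by simpa using h3)
    exact hw (by rw [e2, ← e1, sq])
  · simp only [sub_mulVec, smul_mulVec, one_mulVec, ← mulVec_mulVec, mulVec_add, mulVec_sub,
      mulVec_smul, hFF, hPP, hPFS]
    have : 1 - c ^ 2 = 2 * u * w - u ^ 2 := by linear_combination -hu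
    match_scalars
    · linear_combination this
    · ring


/-! ### The random walk on a graph -/

section RandomWalk

open Matrix Finset

variable {V : Type*} [Fintype V] [DecidableEq V] {G : SimpleGraph V} [DecidableRel G.Adj]

lemma degMatrix_inv {K : Type*} [Field K] [CharZero K] (hd : ∀ v, 0 < G.degree v) :
    (G.degMatrix K)⁻¹ = diagonal fun v => ((G.degree v : K))⁻¹ := by
  apply inv_eq_right_inv
  rw [SimpleGraph.degMatrix, diagonal_mul_diagonal, ← diagonal_one]
  congr 1
  ext v
  exact mul_inv_cancel₀ (by exact_mod_cast (hd v).ne')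

lemma transitionMatrix_apply (hd : ∀ v, 0 < G.degree v) (i j : V) :
    transitionMatrix G i j = (G.degree i : ℝ)⁻¹ * G.adjMatrix ℝ i j := by
  rw [transitionMatrix, degMatrix_inv hd, diagonal_mul]

lemma transitionMatrix_mulVec_eq_iff (hd : ∀ v, 0 < G.degree v) {w : ℝ} {v : V → ℝ} :
    transitionMatrix G *ᵥ v = w • v ↔
      G.adjMatrix ℝ *ᵥ v = w • (G.degMatrix ℝ *ᵥ v) := by
  have hd' : ∀ i, (G.degree i : ℝ) ≠ 0 := fun i => by exact_mod_cast (hd i).ne'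
  rw [transitionMatrix, degMatrix_inv hd, ← mulVec_mulVec, funext_iff, funext_iff]
  refine forall_congr' fun i => ?_
  rw [mulVec_diagonal, Pi.smul_apply, Pi.smul_apply, SimpleGraph.degMatrix_mulVec_apply,
    smul_eq_mul, smul_eq_mul, inv_mul_eq_iff_eq_mul₀ (hd' i)]
  ring_nf

lemma lapMatrix_mulVec_of_eigenvector {w : ℝ} {v : V → ℝ}
    (h : G.adjMatrix ℝ *ᵥ v = w • (G.degMatrix ℝ *ᵥ v)) :
    G.lapMatrix ℝ *ᵥ v = (1 - w) • (G.degMatrix ℝ *ᵥ v) := by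
  rw [SimpleGraph.lapMatrix, sub_mulVec, h, sub_smul, one_smul]

lemma dotProduct_degMatrix_pos (hd : ∀ v, 0 < G.degree v) {v : V → ℝ} (hv : v ≠ 0) :
    0 < v ⬝ᵥ (G.degMatrix ℝ *ᵥ v) := by
  rw [SimpleGraph.dotProduct_mulVec_degMatrix]
  obtain ⟨i, hi⟩ := Function.ne_iff.1 hv
  have hi : v i ≠ 0 := hi
  have hd' : ∀ i, (0 : ℝ) < G.degree i := fun i => by exact_mod_cast hd i
  refine sum_pos' (fun j _ => ?_) ⟨i, mem_univ _, ?_⟩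
  · rw [mul_assoc]; exact mul_nonneg (hd' j).le (mul_self_nonneg _)
  · rw [mul_assoc]; exact mul_pos (hd' i) (mul_self_pos.2 hi)

/-- The signless Laplacian is a sum of squares `(v i + v j)²` over edges. It bounds the spectrum of
the walk below, as the Laplacian bounds it above. -/
lemma dotProduct_degMatrix_add_adjMatrix_nonneg (v : V → ℝ) :
    0 ≤ v ⬝ᵥ (G.degMatrix ℝ *ᵥ v) + v ⬝ᵥ (G.adjMatrix ℝ *ᵥ v) := by
  have h1 : v ⬝ᵥ (G.degMatrix ℝ *ᵥ v) = ∑ i, ∑ j, if G.Adj i j then v i ^ 2 else 0 := by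
    simp_rw [SimpleGraph.dotProduct_mulVec_degMatrix, SimpleGraph.degree_eq_sum_if_adj, sum_mul,
      ite_mul, one_mul, zero_mul, pow_two]
  have h2 : v ⬝ᵥ (G.degMatrix ℝ *ᵥ v) = ∑ i, ∑ j, if G.Adj i j then v j ^ 2 else 0 := by
    rw [h1, sum_comm]
    simp_rw [SimpleGraph.adj_comm]
  have h3 : v ⬝ᵥ (G.adjMatrix ℝ *ᵥ v) = ∑ i, ∑ j, if G.Adj i j then v i * v j else 0 := by
    rw [SimpleGraph.dotProduct_mulVec_adjMatrix]
  have h4 : 2 * (v ⬝ᵥ (G.degMatrix ℝ *ᵥ v) + v ⬝ᵥ (G.adjMatrix ℝ *ᵥ v)) =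
      ∑ i, ∑ j, if G.Adj i j then (v i + v j) ^ 2 else 0 := by
    have : ∀ i j, (if G.Adj i j then (v i + v j) ^ 2 else 0) =
        (if G.Adj i j then v i ^ 2 else 0) + (if G.Adj i j then v j ^ 2 else 0) +
          2 * (if G.Adj i j then v i * v j else 0) := by
      intro i j; split_ifs <;> ring
    simp_rw [this, sum_add_distrib, ← mul_sum]
    rw [← h1, ← h2, ← h3]
    ring
  have h5 : (0 : ℝ) ≤ ∑ i, ∑ j, if G.Adj i j then (v i + v j) ^ 2 else 0 :=
    sum_nonneg fun i _ => sum_nonneg fun j _ => by split_ifs <;> positivity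
  linarith

lemma eigenvalue_le_one (hd : ∀ v, 0 < G.degree v) {w : ℝ} {v : V → ℝ} (hv : v ≠ 0)
    (h : transitionMatrix G *ᵥ v = w • v) : w ≤ 1 := by
  have h1 := lapMatrix_mulVec_of_eigenvector ((transitionMatrix_mulVec_eq_iff hd).1 h)
  have h2 := (G.posSemidef_lapMatrix ℝ).dotProduct_mulVec_nonneg v
  rw [star_trivial, h1, dotProduct_smul, smul_eq_mul] at h2
  have := nonneg_of_mul_nonneg_left h2 (dotProduct_degMatrix_pos hd hv)
  linarith

lemma neg_one_le_eigenvalue (hd : ∀ v, 0 < G.degree v) {w : ℝ} {v : V → ℝ} (hv : v ≠ 0)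
    (h : transitionMatrix G *ᵥ v = w • v) : -1 ≤ w := by
  have h2 := dotProduct_degMatrix_add_adjMatrix_nonneg (G := G) v
  rw [(transitionMatrix_mulVec_eq_iff hd).1 h, dotProduct_smul, smul_eq_mul, ← one_add_mul] at h2
  have := nonneg_of_mul_nonneg_left h2 (dotProduct_degMatrix_pos hd hv)
  linarith

lemma eigenvector_one_eq_const (hconn : G.Connected) (hd : ∀ v, 0 < G.degree v) {v : V → ℝ}
    (h : transitionMatrix G *ᵥ v = (1 : ℝ) • v) : ∃ α : ℝ, v = fun _ => α := by
  have h1 := lapMatrix_mulVec_of_eigenvector ((transitionMatrix_mulVec_eq_iff hd).1 h)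
  rw [sub_self, zero_smul, SimpleGraph.lapMatrix_mulVec_eq_zero_iff_forall_reachable] at h1
  obtain ⟨a⟩ := hconn.nonempty
  exact ⟨v a, funext fun i => h1 _ _ (hconn.preconnected i a)⟩

lemma transitionMatrix_mulVec_one (hd : ∀ v, 0 < G.degree v) :
    transitionMatrix G *ᵥ (fun _ => 1) = (1 : ℝ) • fun _ => 1 := by
  rw [transitionMatrix_mulVec_eq_iff hd]
  ext i
  simp [SimpleGraph.degMatrix_mulVec_apply]

/-- Complex eigenvalues of the transition matrix are real, with real eigenvectors. -/
lemma exists_real_eigenvector (hd : ∀ v, 0 < G.degree v) {w : ℂ} {v : V → ℂ} (hv : v ≠ 0)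
    (h : (transitionMatrix G).map Complex.ofReal *ᵥ v = w • v) :
    ∃ r : ℝ, w = r ∧ ∃ x : V → ℝ, x ≠ 0 ∧ transitionMatrix G *ᵥ x = r • x := by
  have hd' : ∀ i, (G.degree i : ℂ) ≠ 0 := fun i => by exact_mod_cast (hd i).ne'
  have hA : G.adjMatrix ℂ *ᵥ v = w • (G.degMatrix ℂ *ᵥ v) := by
    ext i
    have := congrFun h i
    simp only [mulVec, dotProduct, map_apply, transitionMatrix_apply hd, Complex.ofReal_mul,
      Complex.ofReal_inv, Complex.ofReal_natCast, mul_assoc, ← mul_sum, Pi.smul_apply,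
      smul_eq_mul] at this
    rw [inv_mul_eq_iff_eq_mul₀ (hd' i)] at this
    rw [Pi.smul_apply, SimpleGraph.degMatrix_mulVec_apply, smul_eq_mul, mul_left_comm, ← this]
    simp only [mulVec, dotProduct, SimpleGraph.adjMatrix_apply]
    refine sum_congr rfl fun j _ => ?_
    split_ifs <;> simp
  have him := (G.isHermitian_adjMatrix ℂ).im_star_dotProduct_mulVec_self v
  have hdeg : star v ⬝ᵥ (G.degMatrix ℂ *ᵥ v) =
      ((∑ i, (G.degree i : ℝ) * Complex.normSq (v i) : ℝ) : ℂ) := by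
    simp only [dotProduct, SimpleGraph.degMatrix_mulVec_apply, Complex.ofReal_sum,
      Complex.ofReal_mul, Complex.ofReal_natCast, Complex.normSq_eq_conj_mul_self, Pi.star_apply]
    refine sum_congr rfl fun i _ => ?_
    simp only [RCLike.star_def]
    ring
  have hpos : 0 < ∑ i, (G.degree i : ℝ) * Complex.normSq (v i) := by
    obtain ⟨i, hi⟩ := Function.ne_iff.1 hv
    exact sum_pos' (fun j _ => mul_nonneg (Nat.cast_nonneg _) (Complex.normSq_nonneg _))
      ⟨i, mem_univ _, mul_pos (by exact_mod_cast hd i) (Complex.normSq_pos.2 hi)⟩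
  -- The form of the Hermitian adjacency matrix is real, and equals `w` times the positive degree
  -- form; so `w` is real.
  rw [hA, dotProduct_smul, hdeg, smul_eq_mul] at him
  have him' : w.im = 0 := by
    have : w.im * ∑ i, (G.degree i : ℝ) * Complex.normSq (v i) = 0 := by
      simpa [-Complex.ofReal_sum, Complex.im_mul_ofReal] using him
    exact (mul_eq_zero.1 this).resolve_right hpos.ne'
  have hw : w = (w.re : ℂ) := Complex.ext rfl (by simpa using him')
  refine ⟨w.re, hw, ?_⟩
  have hre : transitionMatrix G *ᵥ (fun i => (v i).re) = w.re • fun i => (v i).re := by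
    ext i
    have := congrArg Complex.re (congrFun h i)
    rw [hw] at this
    simpa [mulVec, dotProduct] using this
  have him2 : transitionMatrix G *ᵥ (fun i => (v i).im) = w.re • fun i => (v i).im := by
    ext i
    have := congrArg Complex.im (congrFun h i)
    rw [hw] at this
    simpa [mulVec, dotProduct] using this
  by_cases h0 : (fun i => (v i).re) = 0
  · refine ⟨_, fun h1 => hv ?_, him2⟩
    ext i
    exact Complex.ext (congrFun h0 i) (congrFun h1 i)
  · exact ⟨_, h0, hre⟩

omit [DecidableEq V] in
lemma sum_adjMatrix_mulVec (x : V → ℝ) :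
    ∑ i, (G.adjMatrix ℝ *ᵥ x) i = ∑ i, (G.degree i : ℝ) * x i := by
  have h := dotProduct_mulVec (fun _ => 1) (G.adjMatrix ℝ) x
  simpa [dotProduct, SimpleGraph.adjMatrix_vecMul_apply] using h

/-- The variational principle on the orthogonal complement of the constants. -/
lemma exists_eigenvalue_nonneg (hd : ∀ v, 0 < G.degree v) {x : V → ℝ} (hx : x ≠ 0)
    (hx0 : ∑ i, (G.degree i : ℝ) * x i = 0) (hxA : 0 ≤ x ⬝ᵥ (G.adjMatrix ℝ *ᵥ x)) :
    ∃ (w : ℝ) (v : V → ℝ), 0 ≤ w ∧ v ≠ 0 ∧ ∑ i, (G.degree i : ℝ) * v i = 0 ∧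
      transitionMatrix G *ᵥ v = w • v := by
  set s : V → ℝ := fun i => √(G.degree i) with hs
  have hd' : ∀ i, (0 : ℝ) < G.degree i := fun i => by exact_mod_cast hd i
  have hs0 : ∀ i, s i ≠ 0 := fun i => (Real.sqrt_pos.2 (hd' i)).ne'
  have hss : ∀ i, s i * s i = G.degree i := fun i => Real.mul_self_sqrt (hd' i).le
  set τ : ℝ := ∑ i, (G.degree i : ℝ) with hτ
  have hτ0 : 0 < τ := by
    obtain ⟨i, _⟩ := Function.ne_iff.1 hx
    exact sum_pos (fun j _ => hd' j) ⟨i, mem_univ _⟩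
  -- Minus the symmetrized walk, plus a rank-one term that moves the eigenvalue of the vector `s`
  -- from `-1` to `1`. A nonpositive eigenvalue of `N` thus belongs to the orthogonal complement of
  -- `s`.
  set N : Matrix V V ℝ := of fun i j => 2 / τ * s i * s j - G.adjMatrix ℝ i j / (s i * s j) with hN
  have hNherm : N.IsHermitian := by
    ext i j
    simp only [hN, conjTranspose_apply, of_apply, star_trivial, SimpleGraph.adjMatrix_apply,
      SimpleGraph.adj_comm]
    ring
  have hNmul : ∀ (z : V → ℝ) (i : V), s i * (N *ᵥ (fun j => s j * z j)) i =
      2 / τ * (∑ j, (G.degree j : ℝ) * z j) * G.degree i - (G.adjMatrix ℝ *ᵥ z) i := by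
    intro z i
    simp only [mulVec, dotProduct, hN, of_apply, mul_sum, sum_mul, ← sum_sub_distrib]
    refine sum_congr rfl fun j _ => ?_
    rw [← hss i, ← hss j]
    have := hs0 i
    have := hs0 j
    field_simp
  have hnpd : ¬ N.PosDef := by
    intro h
    have hz : (fun j => s j * x j) ≠ 0 := by
      intro h0
      apply hx
      ext j
      exact (mul_eq_zero.1 (congrFun h0 j)).resolve_left (hs0 j)
    have h1 := h.dotProduct_mulVec_pos hz
    have h2 : star (fun j => s j * x j) ⬝ᵥ (N *ᵥ fun j => s j * x j) =
        - (x ⬝ᵥ (G.adjMatrix ℝ *ᵥ x)) := by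
      rw [star_trivial, dotProduct, dotProduct, ← sum_neg_distrib]
      refine sum_congr rfl fun i _ => ?_
      rw [mul_comm (s i), mul_assoc, hNmul, hx0]
      ring
    rw [h2] at h1
    linarith
  rw [hNherm.posDef_iff_eigenvalues_pos] at hnpd
  push Not at hnpd
  obtain ⟨k, hk⟩ := hnpd
  set μ := hNherm.eigenvalues k
  have hz := hNherm.mulVec_eigenvectorBasis k
  have hz0 : (⇑(hNherm.eigenvectorBasis k) : V → ℝ) ≠ 0 := by
    intro h
    have := hNherm.eigenvectorBasis.orthonormal.ne_zero k
    apply this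
    ext i
    exact congrFun h i
  generalize (⇑(hNherm.eigenvectorBasis k) : V → ℝ) = z at hz hz0
  set v : V → ℝ := fun i => z i / s i with hv
  have hzv : z = fun j => s j * v j := by
    ext j
    simp only [hv]
    field_simp [hs0 j]
  have hAv : ∀ i, (G.adjMatrix ℝ *ᵥ v) i =
      2 / τ * (∑ j, (G.degree j : ℝ) * v j) * G.degree i - μ * (G.degree i * v i) := by
    intro i
    have h1 := hNmul v i
    rw [← hzv, hz, Pi.smul_apply, smul_eq_mul, hzv] at h1
    rw [← hss i] at h1 ⊢
    linear_combination h1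
  have hσ : ∑ j, (G.degree j : ℝ) * v j = 0 := by
    have h1 := sum_adjMatrix_mulVec (G := G) v
    simp_rw [hAv, sum_sub_distrib, ← mul_sum] at h1
    rw [← hτ] at h1
    set σ := ∑ j, (G.degree j : ℝ) * v j
    have h2 : 2 / τ * σ * τ = 2 * σ := by field_simp
    rw [h2] at h1
    -- Since `μ ≤ 0`, the factor `1 - μ` is nonzero; this is why the rank-one term carries the
    -- coefficient `2`.
    have h3 : (1 - μ) * σ = 0 := by linarith
    exact (mul_eq_zero.1 h3).resolve_left (by linarith)
  refine ⟨-μ, v, by linarith, fun h => hz0 ?_, hσ, ?_⟩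
  · rw [hzv, h]; ext; simp
  · rw [transitionMatrix_mulVec_eq_iff hd]
    ext i
    rw [hAv, hσ, Pi.smul_apply, SimpleGraph.degMatrix_mulVec_apply, smul_eq_mul]
    ring

/-- Of two distinct vertices, the one of smaller degree forms an admissible singleton. The infimum
is thus over a nonempty finite set and is attained. -/
lemma exists_conductance_eq [Nontrivial V] :
    ∃ S : Finset V, S.Nonempty ∧ 2 * vol G S ≤ vol G univ ∧
      conductance G = (cut G S : ℝ) / (vol G S : ℝ) := by
  have hfin : {r : ℝ | ∃ S : Finset V, S.Nonempty ∧ 2 * vol G S ≤ vol G univ ∧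
      r = (cut G S : ℝ) / (vol G S : ℝ)}.Finite := by
    refine (Set.finite_range fun S : Finset V => (cut G S : ℝ) / (vol G S : ℝ)).subset ?_
    rintro r ⟨S, -, -, rfl⟩
    exact ⟨S, rfl⟩
  refine Set.Nonempty.csInf_mem ?_ hfin
  have hpair : ∀ a b : V, a ≠ b → G.degree a ≤ G.degree b → ∃ S : Finset V, S.Nonempty ∧
      2 * vol G S ≤ vol G univ := by
    intro a b hab hle
    refine ⟨{a}, singleton_nonempty a, ?_⟩
    have h1 : vol G {a, b} ≤ vol G univ := sum_le_sum_of_subset (subset_univ _)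
    have h2 : vol G {a, b} = G.degree a + G.degree b := sum_pair hab
    have h3 : vol G {a} = G.degree a := sum_singleton _ _
    omega
  obtain ⟨a, b, hab⟩ := exists_pair_ne V
  obtain ⟨S, h1, h2⟩ := (le_total (G.degree a) (G.degree b)).elim (hpair a b hab)
    (hpair b a hab.symm)
  exact ⟨_, S, h1, h2, rfl⟩

lemma sum_adjMatrix_add_cut (S : Finset V) :
    (∑ i ∈ S, ∑ j ∈ S, G.adjMatrix ℝ i j) + cut G S = vol G S := by
  have h1 : (cut G S : ℝ) = ∑ i ∈ S, ∑ j ∈ Sᶜ, G.adjMatrix ℝ i j := by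
    rw [cut, SimpleGraph.interedges, Rel.interedges, card_filter, sum_product]
    simp [SimpleGraph.adjMatrix_apply]
  rw [h1, ← sum_add_distrib, vol, Nat.cast_sum]
  refine sum_congr rfl fun i _ => ?_
  rw [sum_add_sum_compl, SimpleGraph.degree_eq_sum_if_adj]
  simp [SimpleGraph.adjMatrix_apply]

/-- The easy half of Cheeger's inequality, in the form needed here. -/
lemma exists_test_vector [Nontrivial V] (hd : ∀ v, 0 < G.degree v)
    (hcond : conductance G ≤ 1 / 2) :
    ∃ x : V → ℝ, x ≠ 0 ∧ ∑ i, (G.degree i : ℝ) * x i = 0 ∧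
      0 ≤ x ⬝ᵥ (G.adjMatrix ℝ *ᵥ x) := by
  obtain ⟨S, ⟨a, ha⟩, hvol, hS⟩ := exists_conductance_eq (G := G)
  have hp : (0 : ℝ) < vol G S := by
    exact_mod_cast sum_pos (fun i _ => hd i) ⟨a, ha⟩
  have hvol' : 2 * (vol G S : ℝ) ≤ vol G univ := by exact_mod_cast hvol
  have hV : (0 : ℝ) < vol G univ := by linarith
  rw [hS, div_le_iff₀ hp] at hcond
  -- The constant that makes the shifted indicator of `S` degree-orthogonal to the constants; its
  -- adjacency form is then `(1 - α) vol S - cut S`.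
  set α : ℝ := (vol G S : ℝ) / vol G univ with hα
  have hαV : α * vol G univ = vol G S := div_mul_cancel₀ _ hV.ne'
  have hα2 : α ≤ 1 / 2 := by rw [hα, div_le_iff₀ hV]; linarith
  set y : V → ℝ := fun i => if i ∈ S then 1 else 0 with hy
  have hdy : ∑ i, (G.degree i : ℝ) * y i = vol G S := by
    simp [hy, vol]
  have hdd : ∑ i, (G.degree i : ℝ) = vol G univ := by simp [vol]
  have hyy : y ⬝ᵥ (G.adjMatrix ℝ *ᵥ y) = vol G S - cut G S := by
    rw [← sum_adjMatrix_add_cut S]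
    simp [hy, mulVec, dotProduct, -SimpleGraph.adjMatrix_mulVec_apply]
  have hA : ∀ i, (G.adjMatrix ℝ *ᵥ fun j => y j - α) i =
      (G.adjMatrix ℝ *ᵥ y) i - α * G.degree i := by
    intro i
    simp [SimpleGraph.adjMatrix_mulVec_apply, mul_comm]
  refine ⟨fun i => y i - α, fun h => ?_, ?_, ?_⟩
  · have := congrFun h a
    simp [hy, ha] at this
    linarith
  · simp_rw [mul_sub, sum_sub_distrib, ← sum_mul]
    rw [hdy, hdd]; linarith
  · have : (fun i => y i - α) ⬝ᵥ (G.adjMatrix ℝ *ᵥ fun i => y i - α) =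
        y ⬝ᵥ (G.adjMatrix ℝ *ᵥ y) - α * ∑ i, (G.degree i : ℝ) * y i
          - α * ∑ i, (G.adjMatrix ℝ *ᵥ y) i + α * α * ∑ i, (G.degree i : ℝ) := by
      simp_rw [dotProduct, hA, mul_sum, ← sum_sub_distrib, ← sum_add_distrib]
      refine sum_congr rfl fun i _ => ?_
      ring
    rw [this, sum_adjMatrix_mulVec, hdy, hdd, hyy, mul_assoc, hαV]
    nlinarith

/-- The properties of `λ₂(W)` that the optimization uses. -/
lemma omegaStar_spec [Nontrivial V] (hconn : G.Connected) (hd : ∀ v, 0 < G.degree v)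
    (hcond : conductance G ≤ 1 / 2) :
    0 ≤ omegaStar G ∧ omegaStar G < 1 ∧
    (∃ v : V → ℝ, v ≠ 0 ∧ transitionMatrix G *ᵥ v = omegaStar G • v) ∧
    ∀ (w : ℝ) (v : V → ℝ), v ≠ 0 → transitionMatrix G *ᵥ v = w • v → w ≠ 1 →
      w ≤ omegaStar G := by
  have hone : (fun _ => 1 : V → ℝ) ≠ 0 := by
    obtain ⟨a⟩ := hconn.nonempty
    exact Function.ne_iff.2 ⟨a, one_ne_zero⟩
  have h1 : (1 : ℝ) ∈ (transitionMatrix G).charpoly.roots :=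
    mem_roots_charpoly_iff.2 ⟨_, hone, transitionMatrix_mulVec_one hd⟩
  have hle : ∀ (w : ℝ) (v : V → ℝ), v ≠ 0 → transitionMatrix G *ᵥ v = w • v → w ≠ 1 →
      w ≤ omegaStar G := by
    intro w v hv hw hw1
    have := le_secondLargest_map (f := id) h1 (mem_roots_charpoly_iff.2 ⟨v, hv, hw⟩) hw1.symm
      (eigenvalue_le_one hd hv hw) le_rfl
    rwa [Multiset.map_id] at this
  have hsum : (0 : ℝ) < ∑ i, (G.degree i : ℝ) := by
    obtain ⟨a⟩ := hconn.nonempty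
    exact sum_pos (fun j _ => by exact_mod_cast hd j) ⟨a, mem_univ _⟩
  obtain ⟨x, hx, hx0, hxA⟩ := exists_test_vector hd hcond
  obtain ⟨w, v, hw, hv, hv0, hWv⟩ := exists_eigenvalue_nonneg hd hx hx0 hxA
  have hw1 : w ≠ 1 := by
    rintro rfl
    obtain ⟨α, rfl⟩ := eigenvector_one_eq_const hconn hd hWv
    rw [← sum_mul, mul_eq_zero, or_iff_right hsum.ne'] at hv0
    exact hv (by rw [hv0]; rfl)
  -- The degree vector is a left eigenvector of the walk and pairs positively with the constants, so
  -- the eigenvalue `1` is simple.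
  have hcount : (transitionMatrix G).charpoly.roots.count 1 ≤ 1 := by
    refine count_roots_charpoly_le_one (x := fun _ => 1) (y := fun i => (G.degree i : ℝ)) ?_ ?_ ?_
    · ext j
      have : ∀ i, (G.degree i : ℝ) ≠ 0 := fun i => by exact_mod_cast (hd i).ne'
      simp only [vecMul, dotProduct, transitionMatrix_apply hd, mul_inv_cancel_left₀ (this _),
        one_smul, SimpleGraph.adjMatrix_apply]
      rw [SimpleGraph.degree_eq_sum_if_adj]
      simp_rw [SimpleGraph.adj_comm]
    · simpa [dotProduct] using hsum.ne'
    · intro v hv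
      obtain ⟨α, rfl⟩ := eigenvector_one_eq_const hconn hd hv
      exact ⟨α, by ext; simp⟩
  have hcard : 2 ≤ Multiset.card (transitionMatrix G).charpoly.roots := by
    obtain ⟨m, hm⟩ := Multiset.exists_cons_of_mem h1
    have hwm := mem_roots_charpoly_iff.2 ⟨v, hv, hWv⟩
    rw [hm, Multiset.mem_cons, or_iff_right hw1] at hwm
    have := Multiset.card_pos_iff_exists_mem.2 ⟨w, hwm⟩
    rw [hm, Multiset.card_cons]
    omega
  refine ⟨hw.trans (hle w v hv hWv hw1), ?_,
    mem_roots_charpoly_iff.1 (secondLargest_mem hcard), hle⟩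
  by_contra! h
  have h2 := two_le_countP_of_secondLargest (p := (1 ≤ ·)) (fun _ _ hxy hx => le_trans hx hxy)
    (Or.inl hcard) h
  have h3 : (transitionMatrix G).charpoly.roots.countP (1 ≤ ·) =
      (transitionMatrix G).charpoly.roots.count 1 := by
    refine Multiset.countP_congr rfl fun r hr => ?_
    obtain ⟨z, hz, hWz⟩ := mem_roots_charpoly_iff.1 hr
    exact propext ⟨fun h => le_antisymm h (eigenvalue_le_one hd hz hWz), fun h => h.le⟩
  omega

end RandomWalk

/-! ### The factor graph -/

section FactorGraph

open Matrix Finset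

variable {V : Type*} [Fintype V] [DecidableEq V] {G : SimpleGraph V} [DecidableRel G.Adj]

omit [Fintype V] [DecidableRel G.Adj] in
/-- The other factor edge at the same function node. -/
def flip (e : FactorEdge G) : FactorEdge G :=
  ⟨(e.1.1, Sym2.Mem.other' e.2), Sym2.other_mem' e.2⟩

omit [Fintype V] [DecidableRel G.Adj] in
lemma edge_eq (e : FactorEdge G) : (e.1.1 : Sym2 V) = s(e.1.2, (flip e).1.2) :=
  (Sym2.other_spec' e.2).symm

omit [Fintype V] [DecidableRel G.Adj] in
lemma adj_flip (e : FactorEdge G) : G.Adj e.1.2 (flip e).1.2 := by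
  have := e.1.1.2
  rwa [edge_eq e] at this

omit [Fintype V] [DecidableRel G.Adj] in
lemma flip_eq_iff {e e' : FactorEdge G} :
    flip e = e' ↔ e.1.1 = e'.1.1 ∧ e.1.2 ≠ e'.1.2 := by
  constructor
  · rintro rfl
    exact ⟨rfl, (adj_flip e).ne⟩
  · rintro ⟨h1, h2⟩
    have h3 : e'.1.2 ∈ (e.1.1 : Sym2 V) := by rw [h1]; exact e'.2
    rw [edge_eq e, Sym2.mem_iff] at h3
    exact Subtype.ext (Prod.ext h1 (h3.resolve_left h2.symm).symm)

omit [Fintype V] [DecidableRel G.Adj] in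
lemma flip_flip (e : FactorEdge G) : flip (flip e) = e :=
  flip_eq_iff.2 ⟨rfl, (adj_flip e).ne'⟩

/-- `flip` matches the factor edges at `i` with the neighbours of `i`. -/
lemma sum_factorEdge_at {K : Type*} [AddCommMonoid K] (i : V) (h : V → K) :
    ∑ e : FactorEdge G, (if e.1.2 = i then h (flip e).1.2 else 0) =
      ∑ j ∈ G.neighborFinset i, h j := by
  rw [← sum_filter]
  refine sum_bij (fun e _ => (flip e).1.2) ?_ ?_ ?_ ?_
  · intro e he
    rw [mem_filter] at he
    rw [SimpleGraph.mem_neighborFinset, ← he.2]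
    exact adj_flip e
  · intro e he e' he' hee
    rw [mem_filter] at he he'
    refine Subtype.ext (Prod.ext (Subtype.ext ?_) (he.2.trans he'.2.symm))
    rw [edge_eq e, edge_eq e', hee, he.2, he'.2]
  · intro j hj
    rw [SimpleGraph.mem_neighborFinset] at hj
    let e : FactorEdge G := ⟨(⟨s(i, j), hj⟩, i), Sym2.mem_mk_left i j⟩
    refine ⟨e, by simp [e], ?_⟩
    have := edge_eq e
    exact (Sym2.congr_right.1 this).symm
  · intros; rfl

variable (G) in
/-- The permutation matrix of `flip`. -/
def flipMatrix (K : Type*) [Zero K] [One K] : Matrix (FactorEdge G) (FactorEdge G) K :=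
  of fun e e' => if flip e = e' then 1 else 0

lemma flipMatrix_mulVec {K : Type*} [Semiring K] (f : FactorEdge G → K) :
    flipMatrix G K *ᵥ f = fun e => f (flip e) := by
  ext e
  simp [flipMatrix, mulVec, dotProduct]

lemma flipMatrix_mul_self {K : Type*} [Semiring K] :
    flipMatrix G K * flipMatrix G K = 1 := by
  ext e e'
  simp only [mul_apply, flipMatrix, of_apply, ite_mul, one_mul, zero_mul, sum_ite_eq, mem_univ,
    if_true, flip_flip, one_apply]

lemma one_vecMul_flipMatrix {K : Type*} [CommSemiring K] :
    (fun _ => 1) ᵥ* flipMatrix G K = fun _ => 1 := by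
  ext e
  have : ∀ e', (flip e' = e) = (e' = flip e) := fun e' =>
    propext ⟨fun h => by rw [← h, flip_flip], fun h => by rw [h, flip_flip]⟩
  simp [flipMatrix, vecMul, dotProduct, this]

omit [Fintype V] [DecidableRel G.Adj] in
lemma Qmat_eq : Qmat G = 1 - flipMatrix G ℝ := by
  ext e e'
  simp only [Qmat, flipMatrix, of_apply, Matrix.sub_apply, one_apply, flip_eq_iff]
  have h : e = e' ↔ e.1.1 = e'.1.1 ∧ e.1.2 = e'.1.2 := by
    rw [Subtype.ext_iff, Prod.ext_iff]
  simp only [h]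
  by_cases h1 : e.1.1 = e'.1.1 <;> by_cases h2 : e.1.2 = e'.1.2 <;> simp [h1, h2]

lemma Amat_eq {ρ : ℝ} (hρ : 0 < ρ) :
    Amat G ρ = (ρ + 2)⁻¹ • ((ρ + 1) • 1 + flipMatrix G ℝ) := by
  apply inv_eq_right_inv
  rw [Qmat_eq]
  have hF := flipMatrix_mul_self (G := G) (K := ℝ)
  simp only [mul_add, add_mul, sub_mul, smul_sub, mul_smul_comm, smul_mul_assoc, one_mul, mul_one,
    hF, smul_add]
  have h2 : ρ + 2 ≠ 0 := by positivity
  match_scalars <;> field_simp <;> ring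

variable (G) in
/-- Averaging over the factor edges at a variable node. -/
noncomputable def average : Matrix V (FactorEdge G) ℝ :=
  (G.degMatrix ℝ)⁻¹ * (incidence G).transpose

lemma transpose_incidence_mul_mul_incidence :
    (incidence G)ᵀ * (flipMatrix G ℝ * incidence G) = G.adjMatrix ℝ := by
  ext i j
  have h : ∀ e, (flipMatrix G ℝ * incidence G) e j = if (flip e).1.2 = j then 1 else 0 := by
    intro e
    simp only [mul_apply, flipMatrix, incidence, of_apply, ite_mul, one_mul, zero_mul, sum_ite_eq,
      mem_univ, if_true]
  rw [mul_apply]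
  simp only [h, transpose_apply]
  simp only [incidence, of_apply, ite_mul, one_mul, zero_mul]
  rw [sum_factorEdge_at i fun k => if k = j then (1 : ℝ) else 0]
  simp [SimpleGraph.adjMatrix_apply]

lemma transpose_incidence_mul_incidence : (incidence G)ᵀ * incidence G = G.degMatrix ℝ := by
  ext i j
  rw [mul_apply]
  simp only [transpose_apply, incidence, of_apply, SimpleGraph.degMatrix, diagonal_apply]
  by_cases hij : i = j
  · subst hij
    rw [if_pos rfl, ← SimpleGraph.card_neighborFinset_eq_degree, card_eq_sum_ones, Nat.cast_sum,
      ← sum_factorEdge_at]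
    refine sum_congr rfl fun e _ => ?_
    split_ifs <;> simp
  · rw [if_neg hij]
    refine sum_eq_zero fun e _ => ?_
    by_cases h : e.1.2 = i
    · simp [h, hij]
    · simp [h]

lemma Bmat_eq : Bmat G = incidence G * average G := by
  rw [Bmat, transpose_incidence_mul_incidence, average, Matrix.mul_assoc]

lemma average_apply (hd : ∀ v, 0 < G.degree v) (b : V) (e : FactorEdge G) :
    average G b e = if e.1.2 = b then (G.degree b : ℝ)⁻¹ else 0 := by
  rw [average, degMatrix_inv hd, diagonal_mul, transpose_apply, incidence, of_apply]
  simp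

lemma average_mul_incidence (hd : ∀ v, 0 < G.degree v) : average G * incidence G = 1 := by
  rw [average, Matrix.mul_assoc, transpose_incidence_mul_incidence]
  apply nonsing_inv_mul
  rw [SimpleGraph.degMatrix, det_diagonal, isUnit_iff_ne_zero, prod_ne_zero_iff]
  exact fun i _ => by exact_mod_cast (hd i).ne'

lemma average_mul_flip_mul_incidence :
    average G * flipMatrix G ℝ * incidence G = transitionMatrix G := by
  rw [average, Matrix.mul_assoc, Matrix.mul_assoc, transpose_incidence_mul_mul_incidence, transitionMatrix]

/-- Here `A` is `1/2` plus a multiple of `F + ρ/2`. In `A + B - 2BA = B - (2B - 1)A` the `1/2`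
cancels `B` and leaves a scalar. -/
lemma TA_eq {γ ρ : ℝ} (hρ : 0 < ρ) :
    TA G γ ρ = (1 - γ / 2) • 1 + (γ / (2 * (1 + ρ / 2))) •
      (((2 : ℝ) • (incidence G * average G) - 1) * (flipMatrix G ℝ + (ρ / 2) • 1)) := by
  rw [TA, Amat_eq hρ, Bmat_eq]
  simp only [mul_add, sub_mul, smul_sub, mul_smul_comm, smul_mul_assoc, one_mul, mul_one, smul_add]
  have h2 : ρ + 2 ≠ 0 := by positivity
  have h3 : 1 + ρ / 2 ≠ 0 := by positivity
  match_scalars <;> field_simp <;> ring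

/-! Complexification -/

variable (G) in
/-- The complexified incidence matrix. -/
noncomputable def incidenceC : Matrix (FactorEdge G) V ℂ := (incidence G).map Complex.ofReal

variable (G) in
/-- The complexified averaging matrix. -/
noncomputable def averageC : Matrix V (FactorEdge G) ℂ := (average G).map Complex.ofReal

omit [Fintype V] [DecidableRel G.Adj] in
lemma map_flipMatrix : (flipMatrix G ℝ).map Complex.ofReal = flipMatrix G ℂ := by
  ext e e'
  simp only [flipMatrix, map_apply, of_apply]
  split_ifs <;> simp

lemma map_mul_ofReal {l m n : Type*} [Fintype m] (M : Matrix l m ℝ) (N : Matrix m n ℝ) :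
    (M * N).map Complex.ofReal = M.map Complex.ofReal * N.map Complex.ofReal :=
  Matrix.map_mul (f := Complex.ofRealHom)

lemma averageC_mul_incidenceC (hd : ∀ v, 0 < G.degree v) : averageC G * incidenceC G = 1 := by
  rw [averageC, incidenceC, ← map_mul_ofReal, average_mul_incidence hd]
  exact Matrix.map_one _ Complex.ofReal_zero Complex.ofReal_one

lemma averageC_mul_flip_mul_incidenceC :
    averageC G * flipMatrix G ℂ * incidenceC G = (transitionMatrix G).map Complex.ofReal := by
  rw [averageC, incidenceC, ← map_flipMatrix, ← map_mul_ofReal, ← map_mul_ofReal,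
    average_mul_flip_mul_incidence]

lemma map_TA_eq {γ ρ : ℝ} (hρ : 0 < ρ) :
    (TA G γ ρ).map Complex.ofReal =
      ((1 - γ / 2 : ℝ) : ℂ) • 1 + ((γ / (2 * (1 + ρ / 2)) : ℝ) : ℂ) •
      (((2 : ℂ) • (incidenceC G * averageC G) - 1) *
        (flipMatrix G ℂ + ((ρ / 2 : ℝ) : ℂ) • 1)) := by
  rw [TA_eq hρ, incidenceC, averageC, ← map_mul_ofReal, ← map_flipMatrix]
  have hsmul : ∀ (r : ℝ) (M : Matrix (FactorEdge G) (FactorEdge G) ℝ),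
      (r • M).map Complex.ofReal = (r : ℂ) • M.map Complex.ofReal := by
    intro r M; ext; simp
  have hone : (1 : Matrix (FactorEdge G) (FactorEdge G) ℝ).map Complex.ofReal = 1 :=
    Matrix.map_one _ Complex.ofReal_zero Complex.ofReal_one
  rw [Matrix.map_add _ Complex.ofReal_add, hsmul, hsmul, hone, map_mul_ofReal,
    Matrix.map_sub _ Complex.ofReal_sub, hsmul, Matrix.map_add _ Complex.ofReal_add, hsmul, hone]
  norm_num

lemma map_TA_mulVec {γ ρ : ℝ} (hρ : 0 < ρ) (f : FactorEdge G → ℂ) :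
    (TA G γ ρ).map Complex.ofReal *ᵥ f =
      ((1 - γ / 2 : ℝ) : ℂ) • f + ((γ / (2 * (1 + ρ / 2)) : ℝ) : ℂ) •
      (((2 : ℂ) • (incidenceC G * averageC G) - 1) *ᵥ
        (flipMatrix G ℂ *ᵥ f + ((ρ / 2 : ℝ) : ℂ) • f)) := by
  rw [map_TA_eq hρ, add_mulVec, smul_mulVec, smul_mulVec, one_mulVec, ← mulVec_mulVec, add_mulVec,
    smul_mulVec, one_mulVec]

omit [DecidableRel G.Adj] in
lemma incidenceC_mulVec (v : V → ℂ) : incidenceC G *ᵥ v = fun e => v e.1.2 := by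
  ext e
  simp [incidenceC, incidence, mulVec, dotProduct, apply_ite Complex.ofReal]

lemma averageC_mulVec (hd : ∀ v, 0 < G.degree v) (f : FactorEdge G → ℂ) (b : V) :
    (averageC G *ᵥ f) b =
      (G.degree b : ℂ)⁻¹ * ∑ e : FactorEdge G, if e.1.2 = b then f e else 0 := by
  simp [averageC, average_apply hd, mulVec, dotProduct, mul_sum, apply_ite Complex.ofReal]

lemma map_TA_mulVec_one (hd : ∀ v, 0 < G.degree v) {γ ρ : ℝ} (hρ : 0 < ρ) :
    (TA G γ ρ).map Complex.ofReal *ᵥ (fun _ => 1) = (1 : ℂ) • fun _ => 1 := by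
  have h1 : incidenceC G *ᵥ (fun _ => 1) = fun _ => 1 := incidenceC_mulVec _
  have h2 : averageC G *ᵥ (fun _ => 1) = fun _ => 1 := by
    rw [← h1, mulVec_mulVec, averageC_mul_incidenceC hd, one_mulVec]
  rw [map_TA_mulVec hρ, flipMatrix_mulVec, sub_mulVec, smul_mulVec, one_mulVec, ← mulVec_mulVec,
    mulVec_add, mulVec_smul, h2, mulVec_add, mulVec_smul, h1]
  have h3 : (2 : ℂ) + ρ ≠ 0 := by exact_mod_cast (by positivity : (2 + ρ : ℝ) ≠ 0)
  push_cast
  match_scalars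
  field_simp
  ring

lemma one_vecMul_map_TA (hd : ∀ v, 0 < G.degree v) {γ ρ : ℝ} (hρ : 0 < ρ) :
    (fun _ => 1) ᵥ* (TA G γ ρ).map Complex.ofReal = (1 : ℂ) • fun _ => 1 := by
  have h1 : (fun _ => 1) ᵥ* (incidenceC G * averageC G) = fun _ => 1 := by
    ext e
    have hd' : ∀ i, (G.degree i : ℂ) ≠ 0 := fun i => by exact_mod_cast (hd i).ne'
    have h2 : ∀ b, ((fun _ => 1) ᵥ* incidenceC G) b = G.degree b := by
      intro b
      have := sum_factorEdge_at (G := G) (K := ℂ) b fun _ => 1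
      simpa [vecMul, dotProduct, incidenceC, incidence, apply_ite Complex.ofReal] using this
    rw [← vecMul_vecMul, vecMul, dotProduct]
    simp [h2, averageC, average_apply hd, apply_ite Complex.ofReal, hd']
  rw [map_TA_eq hρ, vecMul_add, vecMul_smul, vecMul_smul, vecMul_one, ← vecMul_vecMul, vecMul_sub,
    vecMul_smul, vecMul_one, h1, vecMul_add, vecMul_smul, vecMul_one, sub_vecMul, smul_vecMul,
    one_vecMul_flipMatrix]
  have h3 : (2 : ℂ) + ρ ≠ 0 := by exact_mod_cast (by positivity : (2 + ρ : ℝ) ≠ 0)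
  push_cast
  match_scalars
  field_simp
  ring

lemma complex_eigenvector_one_eq_const (hconn : G.Connected) (hd : ∀ v, 0 < G.degree v)
    {v : V → ℂ} (h : (transitionMatrix G).map Complex.ofReal *ᵥ v = v) :
    ∃ α : ℂ, v = fun _ => α := by
  have hre : transitionMatrix G *ᵥ (fun i => (v i).re) = (1 : ℝ) • fun i => (v i).re := by
    ext i
    have := congrArg Complex.re (congrFun h i)
    simpa [mulVec, dotProduct] using this
  have him : transitionMatrix G *ᵥ (fun i => (v i).im) = (1 : ℝ) • fun i => (v i).im := by
    ext i
    have := congrArg Complex.im (congrFun h i)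
    simpa [mulVec, dotProduct] using this
  obtain ⟨α, hα⟩ := eigenvector_one_eq_const hconn hd hre
  obtain ⟨β, hβ⟩ := eigenvector_one_eq_const hconn hd him
  exact ⟨⟨α, β⟩, funext fun i => Complex.ext (congrFun hα i) (congrFun hβ i)⟩

/-- The fixed vectors of the iteration are constant, and every other eigenvalue comes from an
eigenvalue of the random walk or is `1 - γ` or `1 - γ ρ / (ρ + 2)`. -/
lemma eigenvalue_cases (hconn : G.Connected) (hd : ∀ v, 0 < G.degree v) {c : ℝ} (hc : 0 < c)
    {u : ℂ} {f : FactorEdge G → ℂ} (hf : f ≠ 0)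
    (hu : ((2 : ℂ) • (incidenceC G * averageC G) - 1) *ᵥ
      (flipMatrix G ℂ *ᵥ f + (c : ℂ) • f) = u • f) :
    (u = 1 + c ∧ ∃ α : ℂ, f = α • fun _ => 1) ∨ (u = 1 - c ∨ u = -(1 + c)) ∨
      ∃ (w : ℝ) (x : V → ℝ), x ≠ 0 ∧ transitionMatrix G *ᵥ x = w • x ∧ w ≠ 1 ∧
        2 * u * w = 1 - (c : ℂ) ^ 2 + u ^ 2 := by
  obtain ⟨h1, h2⟩ := eigenvector_project (averageC_mul_incidenceC hd) flipMatrix_mul_self hu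
  rw [averageC_mul_flip_mul_incidenceC] at h2
  set v := averageC G *ᵥ f with hv
  by_cases hv0 : v = 0
  · right; left
    rw [hv0] at h1
    simp only [mulVec_zero, smul_zero, sub_zero] at h1
    -- If `f` averages to zero at every vertex, the projection formula leaves only `(c + u)² = 1`.
    have h3 : 1 - (c + u) ^ 2 = 0 := (smul_eq_zero.1 h1).resolve_right hf
    have h4 : (u - (1 - c)) * (u + (1 + c)) = 0 := by linear_combination -h3
    rcases mul_eq_zero.1 h4 with h | h
    · exact Or.inl (sub_eq_zero.1 h)
    · exact Or.inr (eq_neg_of_add_eq_zero_left h)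
  by_cases hu0 : u = 0
  · right; left
    rw [hu0, mul_zero, zero_smul, add_zero] at h2
    have h3 : 1 - (c : ℂ) ^ 2 = 0 := (smul_eq_zero.1 h2).resolve_right hv0
    have h4 : (1 - (c : ℂ)) * (1 + c) = 0 := by linear_combination h3
    have h5 : (1 : ℂ) + c ≠ 0 := by exact_mod_cast (by positivity : (1 + c : ℝ) ≠ 0)
    left
    rw [hu0, (mul_eq_zero.1 h4).resolve_right h5]
  have hW : (transitionMatrix G).map Complex.ofReal *ᵥ v =
      ((1 - (c : ℂ) ^ 2 + u ^ 2) / (2 * u)) • v := by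
    have h2u : 2 * u ≠ 0 := mul_ne_zero two_ne_zero hu0
    apply smul_right_injective _ h2u
    simp only [smul_smul]
    rw [mul_div_cancel₀ _ h2u]
    linear_combination (norm := module) -h2
  obtain ⟨w, hw, x, hx, hWx⟩ := exists_real_eigenvector hd hv0 hW
  have hquad : 2 * u * w = 1 - (c : ℂ) ^ 2 + u ^ 2 := by
    rw [← hw]; field_simp
  by_cases hw1 : w = 1
  · rw [hw1, Complex.ofReal_one] at hquad
    have h4 : (u - (1 - c)) * (u - (1 + c)) = 0 := by linear_combination -hquad
    rcases mul_eq_zero.1 h4 with h | h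
    · exact Or.inr (Or.inl (Or.inl (sub_eq_zero.1 h)))
    left
    have hu1 : u = 1 + c := sub_eq_zero.1 h
    refine ⟨hu1, ?_⟩
    rw [hw, hw1, Complex.ofReal_one, one_smul] at hW
    obtain ⟨α, hα⟩ := complex_eigenvector_one_eq_const hconn hd hW
    rw [hα, incidenceC_mulVec, flipMatrix_mulVec] at h1
    -- With `u = 1 + c` this coefficient is `-4c(1+c)`, so the projection formula recovers `f` from
    -- its constant average.
    have h5 : (1 - ((c : ℂ) + u) ^ 2) ≠ 0 := by
      rw [hu1]
      have : (1 - ((c : ℂ) + (1 + c)) ^ 2) = ((-(4 * c * (1 + c)) : ℝ) : ℂ) := by push_cast; ring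
      rw [this, Complex.ofReal_ne_zero]
      exact (neg_neg_of_pos (by positivity)).ne
    refine ⟨(1 - ((c : ℂ) + u) ^ 2)⁻¹ * (2 * u * (1 - (c + u)) * α), ?_⟩
    apply smul_right_injective _ h5
    simp only [smul_smul]
    rw [h1, mul_inv_cancel_left₀ h5]
    ext e
    simp
    ring
  · exact Or.inr (Or.inr ⟨w, x, hx, hWx, hw1, hquad⟩)

/-! Alternating functions along a walk -/

omit [Fintype V] [DecidableRel G.Adj] in
/-- The signed indicator of the edges of a walk, with alternating signs. -/
def alternating : ∀ {u v : V}, G.Walk u v → Sym2 V → ℂ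
  | _, _, .nil, _ => 0
  | u, _, .cons (v := v) _ p, e => (if e = s(u, v) then 1 else 0) - alternating p e

omit [Fintype V] [DecidableRel G.Adj] in
lemma alternating_eq_zero {u v : V} (p : G.Walk u v) {e : Sym2 V} (he : e ∉ p.edges) :
    alternating p e = 0 := by
  induction p with
  | nil => rfl
  | cons h p ih =>
    rw [SimpleGraph.Walk.edges_cons, List.mem_cons, not_or] at he
    rw [alternating, if_neg he.1, ih he.2, sub_zero]

/-- Telescoping: at each interior vertex of the walk the two incident steps carry opposite signs.
Only the ends survive, and they cancel for a closed walk of even length. -/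
lemma sum_alternating {u v : V} (p : G.Walk u v) (b : V) :
    ∑ j ∈ G.neighborFinset b, alternating p s(b, j) =
      (if u = b then 1 else 0) - (-1) ^ p.length * (if v = b then 1 else 0) := by
  induction p with
  | nil => simp [alternating]
  | @cons u v w h p ih =>
    simp only [alternating, sum_sub_distrib, ih, SimpleGraph.Walk.length_cons]
    have : ∑ j ∈ G.neighborFinset b, (if s(b, j) = s(u, v) then (1 : ℂ) else 0) =
        (if u = b then 1 else 0) + (if v = b then 1 else 0) := by
      by_cases hu : u = b
      · subst hu
        simp only [Sym2.congr_right]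
        simp [h, h.ne']
      · by_cases hv : v = b
        · subst hv
          simp only [Sym2.eq_swap (a := u), Sym2.congr_right]
          simp [h.symm, hu]
        · rw [if_neg hu, if_neg hv, add_zero]
          refine sum_eq_zero fun j _ => if_neg fun h => ?_
          have : b ∈ s(u, v) := h ▸ Sym2.mem_mk_left b j
          rcases Sym2.mem_iff.1 this with h | h
          · exact hu h.symm
          · exact hv h.symm
    rw [this, pow_succ]
    ring

/-- An even cycle gives a vector that is fixed by the flip and averages to zero. -/
lemma exists_flip_fixed (hd : ∀ v, 0 < G.degree v) {v : V} {p : G.Walk v v} (hp : p.IsCycle)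
    (heven : Even p.length) :
    ∃ f : FactorEdge G → ℂ, f ≠ 0 ∧ flipMatrix G ℂ *ᵥ f = f ∧ averageC G *ᵥ f = 0 := by
  refine ⟨fun e => alternating p e.1.1, ?_, ?_, ?_⟩
  · cases p with
    | nil => exact absurd rfl hp.ne_nil
    | @cons _ w _ h q =>
      refine Function.ne_iff.2 ⟨⟨(⟨s(v, w), h⟩, v), Sym2.mem_mk_left v w⟩, ?_⟩
      -- A cycle does not repeat its first edge, so the alternating function equals `1` there.
      have hq : s(v, w) ∉ q.edges := ((SimpleGraph.Walk.cons_isCycle_iff q h).1 hp).2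
      simp [alternating, alternating_eq_zero q hq]
  · rw [flipMatrix_mulVec]; rfl
  · ext b
    rw [averageC_mulVec hd]
    have h1 : ∀ e : FactorEdge G, (if e.1.2 = b then alternating p e.1.1 else 0) =
        if e.1.2 = b then alternating p s(b, (flip e).1.2) else 0 := by
      intro e
      split_ifs with h
      · rw [edge_eq e, h]
      · rfl
    simp_rw [h1]
    rw [sum_factorEdge_at b fun j => alternating p s(b, j), sum_alternating, heven.neg_one_pow]
    simp

end FactorGraph

/-! ### The convergence rate -/

section Rate

open Matrix Finset

variable {V : Type*} [Fintype V] [DecidableEq V] {G : SimpleGraph V} [DecidableRel G.Adj]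

lemma one_mem_roots_TA [Nonempty (FactorEdge G)] (hd : ∀ v, 0 < G.degree v) {γ ρ : ℝ}
    (hρ : 0 < ρ) : (1 : ℂ) ∈ ((TA G γ ρ).map Complex.ofReal).charpoly.roots :=
  mem_roots_charpoly_iff.2 ⟨fun _ => 1,
    Function.ne_iff.2 ⟨Classical.arbitrary _, one_ne_zero⟩, map_TA_mulVec_one hd hρ⟩

lemma mem_roots_TA {γ ρ : ℝ} (hρ : 0 < ρ) {u : ℂ} {f : FactorEdge G → ℂ} (hf : f ≠ 0)
    (hu : ((2 : ℂ) • (incidenceC G * averageC G) - 1) *ᵥ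
      (flipMatrix G ℂ *ᵥ f + ((ρ / 2 : ℝ) : ℂ) • f) = u • f) :
    ((1 - γ / 2 : ℝ) : ℂ) + ((γ / (2 * (1 + ρ / 2)) : ℝ) : ℂ) * u ∈
      ((TA G γ ρ).map Complex.ofReal).charpoly.roots := by
  refine mem_roots_charpoly_iff.2 ⟨f, hf, ?_⟩
  rw [map_TA_mulVec hρ, hu, smul_smul, ← add_smul]

lemma exists_eigenvector_of_mem_roots_TA {γ ρ : ℝ} (hγ : 0 < γ) (hρ : 0 < ρ) {z : ℂ}
    {f : FactorEdge G → ℂ} (hz : (TA G γ ρ).map Complex.ofReal *ᵥ f = z • f) :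
    ∃ u : ℂ, z = ((1 - γ / 2 : ℝ) : ℂ) + ((γ / (2 * (1 + ρ / 2)) : ℝ) : ℂ) * u ∧
      ((2 : ℂ) • (incidenceC G * averageC G) - 1) *ᵥ
        (flipMatrix G ℂ *ᵥ f + ((ρ / 2 : ℝ) : ℂ) • f) = u • f := by
  have hb : ((γ / (2 * (1 + ρ / 2)) : ℝ) : ℂ) ≠ 0 :=
    Complex.ofReal_ne_zero.2 (by positivity)
  rw [map_TA_mulVec hρ] at hz
  generalize ((γ / (2 * (1 + ρ / 2)) : ℝ) : ℂ) = b at *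
  generalize ((1 - γ / 2 : ℝ) : ℂ) = a at *
  refine ⟨(z - a) / b, by field_simp; ring, ?_⟩
  apply smul_right_injective _ hb
  simp only [smul_smul]
  rw [mul_div_cancel₀ _ hb, sub_smul, ← hz, add_sub_cancel_left]

lemma one_sub_mem_roots_TA (hd : ∀ v, 0 < G.degree v) {v : V} {p : G.Walk v v} (hp : p.IsCycle)
    (heven : Even p.length) {γ ρ : ℝ} (hρ : 0 < ρ) :
    (1 - γ : ℂ) ∈ ((TA G γ ρ).map Complex.ofReal).charpoly.roots := by
  obtain ⟨f, hf, hF, hP⟩ := exists_flip_fixed hd hp heven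
  have h := mem_roots_TA (γ := γ) hρ (u := -(1 + ((ρ / 2 : ℝ) : ℂ))) hf (by
    rw [hF, sub_mulVec, smul_mulVec, one_mulVec, ← mulVec_mulVec, mulVec_add, mulVec_smul, hP]
    simp only [smul_zero, add_zero, mulVec_zero]
    module)
  convert h using 1
  have h3 : (2 : ℂ) + ρ ≠ 0 := by exact_mod_cast (by positivity : (2 + ρ : ℝ) ≠ 0)
  push_cast
  field_simp
  ring

lemma sub_one_le_rate (hd : ∀ v, 0 < G.degree v) [Nonempty (FactorEdge G)] {v : V}
    {p : G.Walk v v} (hp : p.IsCycle) (heven : Even p.length) {γ ρ : ℝ} (hγ : 0 < γ)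
    (hγ2 : γ < 2) (hρ : 0 < ρ) : γ - 1 ≤ rate G γ ρ := by
  refine le_secondLargest_map (one_mem_roots_TA hd hρ) (one_sub_mem_roots_TA hd hp heven hρ)
    ?_ ?_ ?_
  · intro h
    have : (γ : ℂ) = 0 := by linear_combination h
    exact hγ.ne' (by exact_mod_cast this)
  · rw [norm_one]; linarith
  · rw [norm_sub_rev]
    have : (γ - 1 : ℂ) = ((γ - 1 : ℝ) : ℂ) := by push_cast; rfl
    rw [this, Complex.norm_real]
    exact le_abs_self _

lemma count_one_roots_TA [Nonempty (FactorEdge G)] (hconn : G.Connected)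
    (hd : ∀ v, 0 < G.degree v) {γ ρ : ℝ} (hγ : 0 < γ) (hρ : 0 < ρ) :
    ((TA G γ ρ).map Complex.ofReal).charpoly.roots.count 1 ≤ 1 := by
  refine count_roots_charpoly_le_one (one_vecMul_map_TA hd hρ) (x := fun _ => 1) ?_ ?_
  · simp [dotProduct]
  · intro f hf
    by_cases hf0 : f = 0
    · exact ⟨0, by rw [hf0, zero_smul]⟩
    obtain ⟨u, hz, hu⟩ := exists_eigenvector_of_mem_roots_TA hγ hρ hf
    have h2 : (2 : ℂ) + ρ ≠ 0 := by exact_mod_cast (by positivity : (2 + ρ : ℝ) ≠ 0)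
    have hγ' : (γ : ℂ) ≠ 0 := Complex.ofReal_ne_zero.2 hγ.ne'
    have hu1 : u = 1 + ((ρ / 2 : ℝ) : ℂ) := by
      push_cast at hz ⊢
      field_simp at hz
      have : (γ : ℂ) * (2 * u - (2 + ρ)) = 0 := by linear_combination -hz
      have := (mul_eq_zero.1 this).resolve_left hγ'
      linear_combination this / 2
    generalize hc : ρ / 2 = c at hu hu1
    have hc0 : 0 < c := by linarith
    have hcc : (c : ℂ) ≠ 0 := Complex.ofReal_ne_zero.2 hc0.ne'
    have h1c : (1 : ℂ) + c ≠ 0 := by exact_mod_cast (by positivity : (1 + c : ℝ) ≠ 0)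
    rcases eigenvalue_cases hconn hd hc0 hf0 hu with ⟨-, h⟩ | (h | h) | ⟨w, x, hx, hWx, hw1, hq⟩
    · exact h
    · exact absurd (by linear_combination (h - hu1) / 2) hcc
    · exact absurd (by linear_combination (h - hu1) / 2) h1c
    · refine absurd ?_ hw1
      rw [hu1] at hq
      have h3 : (1 + (c : ℂ)) * (w - 1) = 0 := by linear_combination hq / 2
      exact_mod_cast sub_eq_zero.1 ((mul_eq_zero.1 h3).resolve_left h1c)

/-- The rate at the parameters for which the dominant eigenvalues collapse. -/
lemma rate_le_of_double_root [Nontrivial V] [Nonempty (FactorEdge G)] (hconn : G.Connected)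
    (hd : ∀ v, 0 < G.degree v) (hcond : conductance G ≤ 1 / 2) {γ ρ : ℝ} (hγ1 : 1 ≤ γ)
    (hγ2 : γ < 2) (hρ : 0 < ρ) (hρω : (ρ / 2) ^ 2 + omegaStar G ^ 2 = 1)
    (h : (1 - γ / 2) + γ / (2 * (1 + ρ / 2)) * omegaStar G ≤ γ - 1) : rate G γ ρ ≤ γ - 1 := by
  obtain ⟨hω0, hω1, -, hωle⟩ := omegaStar_spec hconn hd hcond
  have hγ : 0 < γ := by linarith
  by_contra! hlt
  -- The default value `0` is harmless because `γ ≥ 1`. It remains to see that `1` is the only root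
  -- of modulus above `γ - 1`, and it is simple.
  have h2 := two_le_countP_of_secondLargest (p := (γ - 1 < ·))
    (fun _ _ hxy hx => lt_of_lt_of_le hx hxy) (Or.inr (by linarith)) hlt
  rw [Multiset.countP_map, ← Multiset.countP_eq_card_filter] at h2
  have h3 : ((TA G γ ρ).map Complex.ofReal).charpoly.roots.countP (fun z => γ - 1 < ‖z‖) =
      ((TA G γ ρ).map Complex.ofReal).charpoly.roots.count 1 := by
    refine Multiset.countP_congr rfl fun z hz => propext ⟨fun hgt => ?_, ?_⟩
    · obtain ⟨f, hf, hTf⟩ := mem_roots_charpoly_iff.1 hz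
      obtain ⟨u, hzu, hu⟩ := exists_eigenvector_of_mem_roots_TA hγ hρ hTf
      set b : ℝ := γ / (2 * (1 + ρ / 2)) with hb
      have hb0 : 0 ≤ b := by positivity
      have ha0 : 0 ≤ 1 - γ / 2 := by linarith
      have hbc : b * (1 + ρ / 2) = γ / 2 := by rw [hb]; field_simp
      set c : ℝ := ρ / 2 with hc
      have hc0 : 0 < c := by positivity
      have hcω : c ^ 2 + omegaStar G ^ 2 = 1 := hρω
      have hl : -(γ - 1) ≤ (1 - γ / 2) - b * (1 + c) := by linarith
      have hc1 : c ≤ 1 := by nlinarith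
      rcases eigenvalue_cases hconn hd hc0 hf hu with ⟨hu1, -⟩ | (hu1 | hu1) | ⟨w, x, hx, hWx, hw1, hq⟩
      · rw [hzu, hu1]
        norm_cast
        linarith
      · refine absurd ?_ (not_le.2 hgt)
        have : z = ((1 - γ / 2 + b * (1 - c) : ℝ) : ℂ) := by rw [hzu, hu1]; push_cast; ring
        rw [this, Complex.norm_real, Real.norm_eq_abs, abs_le]
        -- Indeed `(1-c)² ≤ (1-c)(1+c) = ω²`.
        have h1cω : 1 - c ≤ omegaStar G := by nlinarith
        constructor <;> nlinarith
      · refine absurd ?_ (not_le.2 hgt)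
        have : z = ((1 - γ / 2 - b * (1 + c) : ℝ) : ℂ) := by rw [hzu, hu1]; push_cast; ring
        rw [this, Complex.norm_real, Real.norm_eq_abs, abs_le]
        exact ⟨hl, by linarith⟩
      · refine absurd ?_ (not_le.2 hgt)
        rw [hzu]
        exact norm_le_of_quadratic ha0 hb0 hc0.le hω0 hcω (neg_one_le_eigenvalue hd hx hWx)
          (hωle w x hx hWx hw1) hq h hl
    · rintro rfl
      rw [norm_one]
      linarith
  have := count_one_roots_TA hconn hd hγ hρ
  omega

/-- Being different from `1` is what lets this root count as a second one beside the fixed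
eigenvalue; equality would mean `u = 1 + ρ/2` and hence `ω* = 1`. -/
lemma exists_root_TA_of_eigenvector [Nontrivial V] (hconn : G.Connected)
    (hd : ∀ v, 0 < G.degree v) (hcond : conductance G ≤ 1 / 2) {γ ρ : ℝ} (hγ : 0 < γ)
    (hρ : 0 < ρ) {u : ℂ} (hu : 2 * u * omegaStar G = 1 - ((ρ / 2 : ℝ) : ℂ) ^ 2 + u ^ 2) :
    ((1 - γ / 2 : ℝ) : ℂ) + ((γ / (2 * (1 + ρ / 2)) : ℝ) : ℂ) * u ∈
      ((TA G γ ρ).map Complex.ofReal).charpoly.roots ∧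
    ((1 - γ / 2 : ℝ) : ℂ) + ((γ / (2 * (1 + ρ / 2)) : ℝ) : ℂ) * u ≠ 1 := by
  obtain ⟨hω0, hω1, ⟨v, hv, hWv⟩, -⟩ := omegaStar_spec hconn hd hcond
  have hv' : (fun i => (v i : ℂ)) ≠ 0 := by
    obtain ⟨i, hi⟩ := Function.ne_iff.1 hv
    exact Function.ne_iff.2 ⟨i, Complex.ofReal_ne_zero.2 hi⟩
  have hWv' : (averageC G * flipMatrix G ℂ * incidenceC G) *ᵥ (fun i => (v i : ℂ)) =
      (omegaStar G : ℂ) • fun i => (v i : ℂ) := by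
    rw [averageC_mul_flip_mul_incidenceC]
    ext i
    have := congrArg Complex.ofReal (congrFun hWv i)
    simpa [mulVec, dotProduct] using this
  have hω2 : (omegaStar G : ℂ) ^ 2 ≠ 1 := by
    have : omegaStar G ^ 2 ≠ 1 := by nlinarith
    exact_mod_cast this
  obtain ⟨f, hf, hUf⟩ := eigenvector_lift (averageC_mul_incidenceC hd) flipMatrix_mul_self hv' hω2
    hWv' hu
  refine ⟨mem_roots_TA hρ hf hUf, fun h => ?_⟩
  have h2 : (2 : ℂ) + ρ ≠ 0 := by exact_mod_cast (by positivity : (2 + ρ : ℝ) ≠ 0)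
  have hγ' : (γ : ℂ) ≠ 0 := Complex.ofReal_ne_zero.2 hγ.ne'
  have hu1 : u = 1 + (ρ : ℂ) / 2 := by
    push_cast at h
    field_simp at h
    have : (γ : ℂ) * (2 * u - (2 + ρ)) = 0 := by linear_combination h
    have := (mul_eq_zero.1 this).resolve_left hγ'
    linear_combination this / 2
  rw [hu1] at hu
  push_cast at hu
  have h3 : ((2 : ℂ) + ρ) * (omegaStar G - 1) = 0 := by linear_combination hu
  have h4 : (omegaStar G : ℂ) = 1 := sub_eq_zero.1 ((mul_eq_zero.1 h3).resolve_left h2)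
  exact hω1.ne (by exact_mod_cast h4)

end Rate

/-! ### Closed forms of the optimal parameters -/

section Parameters

variable {V : Type*} [Fintype V] [DecidableEq V] {G : SimpleGraph V} [DecidableRel G.Adj]

lemma gammaStar_eq (h0 : 0 ≤ omegaStar G) (h1 : omegaStar G < 1) :
    gammaStar G = 4 / (3 - omegaStar G / (1 + rhoStar G / 2)) := by
  have hk : √(1 - omegaStar G ^ 2) ^ 2 = 1 - omegaStar G ^ 2 := Real.sq_sqrt (by nlinarith)
  have hk0 : 0 ≤ √(1 - omegaStar G ^ 2) := Real.sqrt_nonneg _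
  rw [gammaStar, rhoStar]
  generalize √(1 - omegaStar G ^ 2) = k at *
  have h2 : 1 + k ≠ 0 := by positivity
  -- From `ω² = (1-k)(1+k)`; the radical in `γ*` is thus the normalized double root `ω/(1+k)`.
  have : (2 - 2 * k) / (2 + 2 * k) = (omegaStar G / (1 + k)) ^ 2 := by
    have h3 : 2 + 2 * k ≠ 0 := by positivity
    rw [div_pow, div_eq_div_iff h3 (by positivity)]
    linear_combination -2 * (1 + k) * hk
  rw [this, Real.sqrt_sq (by positivity), mul_div_cancel_left₀ _ two_ne_zero]

lemma rhoStar_pos (h0 : 0 ≤ omegaStar G) (h1 : omegaStar G < 1) : 0 < rhoStar G :=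
  mul_pos two_pos (Real.sqrt_pos.2 (by nlinarith))

lemma rhoStar_half_sq (h0 : 0 ≤ omegaStar G) (h1 : omegaStar G < 1) :
    (rhoStar G / 2) ^ 2 + omegaStar G ^ 2 = 1 := by
  rw [rhoStar, mul_div_cancel_left₀ _ two_ne_zero, Real.sq_sqrt (by nlinarith)]
  ring

end Parameters

end ConsensusADMM

theorem theorem3 {V : Type*} [Fintype V] [DecidableEq V] (G : SimpleGraph V)
    [DecidableRel G.Adj] (hconn : G.Connected)
    (heven : ∃ (v : V) (c : G.Walk v v), c.IsCycle ∧ Even c.length)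
    (hcond : ConsensusADMM.conductance G ≤ 1 / 2) :
    (0 ≤ ConsensusADMM.omegaStar G ∧ ConsensusADMM.omegaStar G < 1) ∧
    (0 < ConsensusADMM.gammaStar G ∧ ConsensusADMM.gammaStar G < 2) ∧
    0 < ConsensusADMM.rhoStar G ∧
    IsLeast {r : ℝ | ∃ γ ρ : ℝ, 0 < γ ∧ γ < 2 ∧ 0 < ρ ∧ r = ConsensusADMM.rate G γ ρ}
      (ConsensusADMM.gammaStar G - 1) ∧
    (∀ γ ρ : ℝ, 0 < γ → γ < 2 → 0 < ρ →
      (ConsensusADMM.rate G γ ρ = ConsensusADMM.gammaStar G - 1 ↔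
        γ = ConsensusADMM.gammaStar G ∧ ρ = ConsensusADMM.rhoStar G)) := by
  open ConsensusADMM in
  obtain ⟨v, p, hp, hev⟩ := heven
  have hadj : ∃ w, G.Adj v w := by
    cases p with
    | nil => exact absurd rfl hp.ne_nil
    | cons h _ => exact ⟨_, h⟩
  obtain ⟨w, hvw⟩ := hadj
  have : Nontrivial V := ⟨v, w, hvw.ne⟩
  have : Nonempty (FactorEdge G) := ⟨⟨(⟨s(v, w), hvw⟩, v), Sym2.mem_mk_left v w⟩⟩
  have hd : ∀ v, 0 < G.degree v := fun v => hconn.preconnected.degree_pos_of_nontrivial v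
  obtain ⟨h0, h1, -, -⟩ := omegaStar_spec hconn hd hcond
  have hρ := rhoStar_pos h0 h1
  have hρω := rhoStar_half_sq h0 h1
  have hγ := gammaStar_eq h0 h1
  have hg0 : 0 ≤ omegaStar G / (1 + rhoStar G / 2) := by positivity
  have hg1 : omegaStar G / (1 + rhoStar G / 2) < 1 := by
    rw [div_lt_one (by positivity)]; linarith
  -- This is the balance `1 - γ/2 + (γ/2) g = γ - 1` at `γ = γ*`, with `g = ω/(1 + ρ*/2)`.
  have hγeq : gammaStar G * (3 - omegaStar G / (1 + rhoStar G / 2)) = 4 := by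
    rw [hγ]; exact div_mul_cancel₀ _ (by linarith)
  have hγ1 : 1 ≤ gammaStar G := by rw [hγ, le_div_iff₀ (by linarith)]; linarith
  have hγ2 : gammaStar G < 2 := by rw [hγ, div_lt_iff₀ (by linarith)]; linarith
  have hγ0 : 0 < gammaStar G := by linarith
  have hstar : rate G (gammaStar G) (rhoStar G) = gammaStar G - 1 := by
    refine le_antisymm (rate_le_of_double_root hconn hd hcond hγ1 hγ2 hρ hρω ?_)
      (sub_one_le_rate hd hp hev hγ0 hγ2 hρ)
    have : gammaStar G / (2 * (1 + rhoStar G / 2)) * omegaStar G =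
        gammaStar G / 2 * (omegaStar G / (1 + rhoStar G / 2)) := by field_simp
    rw [this]
    linarith
  have hlt : ∀ γ ρ : ℝ, 0 < γ → γ < 2 → 0 < ρ → ¬ (γ = gammaStar G ∧ ρ = rhoStar G) →
      gammaStar G - 1 < rate G γ ρ := by
    intro γ ρ hγ' hγ2' hρ' hne
    rcases lt_or_ge (gammaStar G) γ with hgt | hle
    · exact (sub_lt_sub_right hgt 1).trans_le (sub_one_le_rate hd hp hev hγ' hγ2' hρ')
    · obtain ⟨u, hu, hnorm⟩ := exists_root_norm_gt (half_pos hρ') h0 (half_pos hρ) hρω hγ' hγ2'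
        hle (fun h h' => hne ⟨h, by linarith⟩)
      obtain ⟨hmem, hz1⟩ := exists_root_TA_of_eigenvector hconn hd hcond hγ' hρ' hu
      -- The root found may have modulus above `1`, so the rate is compared with the smaller of `1`
      -- and that modulus; both exceed `γ* - 1`.
      have hmin := le_secondLargest_map (f := fun z : ℂ => ‖z‖) (one_mem_roots_TA hd hρ') hmem
        hz1.symm (min_le_left _ _) (min_le_right _ _)
      refine lt_of_lt_of_le (lt_min ?_ ?_) hmin
      · rw [norm_one]; linarith
      · refine lt_of_eq_of_lt ?_ hnorm
        linarith
  refine ⟨⟨h0, h1⟩, ⟨hγ0, hγ2⟩, hρ, ⟨⟨_, _, hγ0, hγ2, hρ, hstar.symm⟩, ?_⟩, ?_⟩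
  · rintro r ⟨γ, ρ, hγ', hγ2', hρ', rfl⟩
    by_cases h : γ = gammaStar G ∧ ρ = rhoStar G
    · rw [h.1, h.2, hstar]
    · exact (hlt γ ρ hγ' hγ2' hρ' h).le
  · intro γ ρ hγ' hγ2' hρ'
    constructor
    · intro h
      by_contra hne
      exact (hlt γ ρ hγ' hγ2' hρ' hne).ne' h
    · rintro ⟨rfl, rfl⟩
      exact hstar
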